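/- Let $d\ge 1$ be an integer, $0<\alpha<d$, and let $r,p$ be real numbers with $\alpha\le r$ and $1<r<p\le d$. There is a constant $N$ depending only on $\alpha,d,r,p$ such that the following holds. Let $A\ge 0$ and let $b\ge 0$ be a measurable function on $\mathbb{R}^d$ such that for every $\rho>0$ and every open ball $B\subset\mathbb{R}^d$ of radius $\rho$ $$\Big(\frac{1}{|B|}\int_B b^p\,dx\Big)^{1/p}\le A\rho^{-\alpha}.$$ Then for every real-valued $u\in C_0^\infty(\mathbb{R}^d)$ (smooth with compact support) $$\int_{\mathbb{R}^d} b^r|u|^r\,dx\le N A^r\int_{\mathbb{R}^d}\big|(-\Delta)^{\alpha/2}u\big|^r\,dx,$$ where $(-\Delta)^{\alpha/2}$ is the Fourier multiplier operator that corresponds to the $\alpha/2$-th power of the symbol of $-\Delta$ (that is, to $|\xi|^\alpha$ when $-\Delta$ corresponds to $|\xi|^2$). Moreover, if $\alpha=1$ (and hence $d\ge2$), then, with a constant $N$ depending only on $d,r,p$, also $$\int_{\mathbb{R}^d} b^r|u|^r\,dx\le N A^r\int_{\mathbb{R}^d}|Du|^r\,dx,$$ where $Du$ is the gradient of $u$ and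 $|Du|$ its Euclidean norm. -/

import Mathlib

open MeasureTheory
open scoped FourierTransform Gradient ContDiff

/-- The fractional Laplacian `(-Δ)^s u` of a (nice) real function `u` on a Euclidean space: the
Fourier multiplier operator with symbol `(4 π² |ξ|²)^s = (2 π |ξ|)^(2 s)`, where
`𝓕 u ξ = ∫ exp (-2 π i ⟨x, ξ⟩) u x dx`, for which `4 π² |ξ|²` is the symbol of `-Δ`. The values
are complex numbers only because the Fourier transform is complex-valued. -/
noncomputable def fracLaplacian {d : ℕ} (s : ℝ) (u : EuclideanSpace ℝ (Fin d) → ℝ) :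
    EuclideanSpace ℝ (Fin d) → ℂ :=
  𝓕⁻ (fun ξ : EuclideanSpace ℝ (Fin d) =>
    (((2 * Real.pi * ‖ξ‖) ^ (2 * s) : ℝ) : ℂ) *
      𝓕 (fun x : EuclideanSpace ℝ (Fin d) => (u x : ℂ)) ξ)

/-- The Morrey-type condition `(⨍_B b^p dx)^(1/p) ≤ A ρ^(-α)` for all open balls `B` of all radii
`ρ > 0`, where `⨍` is the mean value over `B`. It is stated in `[0, ∞]`, so that it entails local
integrability of `b^p`. -/
def MorreyBound {d : ℕ} (α p A : ℝ) (b : EuclideanSpace ℝ (Fin d) → ℝ) : Prop :=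
  ∀ (x : EuclideanSpace ℝ (Fin d)) (ρ : ℝ), 0 < ρ →
    (⨍⁻ y in Metric.ball x ρ, ENNReal.ofReal (b y ^ p) ∂volume) ^ (1 / p) ≤
      ENNReal.ofReal (A * ρ ^ (-α))

/-!
Both inequalities have the form `∫ b ^ r |u| ^ r ≤ N A ^ r ∫ f ^ r`, where `|u| ≤ K * I_α f` pointwise
for the Riesz potential `I_α f x = ∫ |x - y| ^ (α - d) f y dy`. They follow from two such pointwise
bounds and from one trace inequality for Riesz potentials.

*Pointwise bounds.* For `f = |(-Δ) ^ (α/2) u|`, write `|ξ| ^ (-α)` as an integral over `t` of Gaussians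
`exp (-t |ξ| ^ 2)`. Then `u` is an integral over `t` of convolutions of `(-Δ) ^ (α/2) u` with Gaussians,
and integrating the Gaussians in `t` gives the kernel `|x - y| ^ (α - d)`
(`exists_enorm_le_rieszPotential_multiplier`). For `α = 1` and `f = |Du|`, integrate the derivative
of `u` along rays from `x` and average over the direction
(`exists_enorm_le_rieszPotential_fderiv`).

*Trace inequality.* `exists_lintegral_rpow_mul_rieszPotential_rpow_le` bounds `∫ b ^ r (I_α f) ^ r` by
`C A ^ r ∫ f ^ r`. Let `v = (M (b ^ p)) ^ (1 / p)` with `M` the maximal function, so `b ≤ v` almost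
everywhere. For `0 < t < p` the Coifman–Rochberg estimate
(`exists_dyadicMean_dyadicMaximal_rpow_le`) bounds the mean of `v ^ t` over a ball of radius `ρ`
around `x` by a multiple of both `v x ^ t` and `(A ρ ^ (-α)) ^ t`. If `t > 1`, summing over the
dyadic scales with the better of the two bounds at each gives `I_α (v ^ t) ≤ C A v ^ (t - 1)`
(`exists_rieszPotential_maximalMajorant_rpow_le`). This is all that a Schur test needs: Hölder's
inequality with the weight `v ^ t` leads to `∫ f ^ r v ^ (1 - T) I_α (v ^ T)` with
`T = 1 + t (r - 1)`, and both `t` and `T` lie in `(1, p)` when `t` is close to `1`, because `r < p`.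
-/

set_option linter.unusedSectionVars false

/-! ### Dyadic means and the maximal function -/

section DyadicMeans

open Metric Set Filter Module
open scoped ENNReal Topology

variable {E : Type*} [NormedAddCommGroup E] [NormedSpace ℝ E] [FiniteDimensional ℝ E]
  [MeasurableSpace E] [BorelSpace E] (μ : Measure E) [μ.IsAddHaarMeasure]

/-- The mean value of `g` over the open ball of dyadic radius `2 ^ k` around `x`. -/
noncomputable def dyadicMean (g : E → ℝ≥0∞) (k : ℤ) (x : E) : ℝ≥0∞ :=
  ⨍⁻ y in ball x ((2 : ℝ) ^ k), g y ∂μ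

/-- The centred maximal function of `g`, with the supremum over balls of dyadic radii only. -/
noncomputable def dyadicMaximal (g : E → ℝ≥0∞) (x : E) : ℝ≥0∞ :=
  ⨆ k : ℤ, dyadicMean μ g k x

lemma measure_ball_dyadic_pos (k : ℤ) (x : E) : μ (ball x ((2 : ℝ) ^ k)) ≠ 0 :=
  (measure_ball_pos μ x (by positivity)).ne'

lemma measure_ball_dyadic_succ (k : ℤ) (x y : E) :
    μ (ball x ((2 : ℝ) ^ (k + 1))) = 2 ^ finrank ℝ E * μ (ball y ((2 : ℝ) ^ k)) := by
  rw [zpow_add_one₀ two_ne_zero, mul_comm, Measure.addHaar_ball_mul_of_pos μ x two_pos,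
    Measure.addHaar_ball_center μ y, ENNReal.ofReal_pow two_pos.le]
  simp

lemma dyadicMean_eq (g : E → ℝ≥0∞) (k : ℤ) (x : E) :
    dyadicMean μ g k x = (∫⁻ y in ball x ((2 : ℝ) ^ k), g y ∂μ) / μ (ball x ((2 : ℝ) ^ k)) :=
  setLAverage_eq _ _ _

lemma lintegral_ball_dyadic (g : E → ℝ≥0∞) (k : ℤ) (x : E) :
    ∫⁻ y in ball x ((2 : ℝ) ^ k), g y ∂μ = dyadicMean μ g k x * μ (ball x ((2 : ℝ) ^ k)) := by
  rw [dyadicMean_eq, ENNReal.div_mul_cancel (measure_ball_dyadic_pos μ k x)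
    measure_ball_lt_top.ne]

lemma dyadicMean_le_dyadicMaximal (g : E → ℝ≥0∞) (k : ℤ) (x : E) :
    dyadicMean μ g k x ≤ dyadicMaximal μ g x :=
  le_iSup (fun k => dyadicMean μ g k x) k

lemma measurable_lintegral_ball {g : E → ℝ≥0∞} (hg : Measurable g) (ρ : ℝ) :
    Measurable fun x => ∫⁻ y in ball x ρ, g y ∂μ := by
  have h : Measurable fun q : E × E => ({q : E × E | dist q.2 q.1 < ρ}.indicator
      (fun q => g q.2)) q :=
    (hg.comp measurable_snd).indicator
      (isOpen_lt (by fun_prop) continuous_const).measurableSet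
  have h' := h.lintegral_prod_right' (ν := μ)
  convert h' using 2 with x
  rw [← lintegral_indicator measurableSet_ball]
  rfl

lemma measurable_dyadicMean {g : E → ℝ≥0∞} (hg : Measurable g) (k : ℤ) :
    Measurable (dyadicMean μ g k) := by
  have : dyadicMean μ g k = fun x =>
      (∫⁻ y in ball x ((2 : ℝ) ^ k), g y ∂μ) / μ (ball 0 ((2 : ℝ) ^ k)) := by
    funext x
    rw [dyadicMean_eq, Measure.addHaar_ball_center]
  rw [this]
  exact (measurable_lintegral_ball μ hg _).div_const _

lemma measurable_dyadicMaximal {g : E → ℝ≥0∞} (hg : Measurable g) :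
    Measurable (dyadicMaximal μ g) :=
  Measurable.iSup fun k => measurable_dyadicMean μ hg k

/-- Doubling: a mean is controlled by the mean over a ball of twice the radius with a nearby
centre. -/
lemma dyadicMean_le_succ (g : E → ℝ≥0∞) {k : ℤ} {x y : E} (h : dist y x ≤ (2 : ℝ) ^ k) :
    dyadicMean μ g k y ≤ 2 ^ finrank ℝ E * dyadicMean μ g (k + 1) x := by
  have hsub : ball y ((2 : ℝ) ^ k) ⊆ ball x ((2 : ℝ) ^ (k + 1)) :=
    ball_subset_ball' (by rw [zpow_add_one₀ two_ne_zero]; linarith)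
  rw [dyadicMean_eq]
  refine ENNReal.div_le_of_le_mul ?_
  calc ∫⁻ z in ball y ((2 : ℝ) ^ k), g z ∂μ
      ≤ ∫⁻ z in ball x ((2 : ℝ) ^ (k + 1)), g z ∂μ := lintegral_mono_set hsub
    _ = _ := by
      rw [lintegral_ball_dyadic, measure_ball_dyadic_succ μ k x y]
      ring

/-- The weak type `(1, 1)` inequality, by the Vitali covering lemma. -/
lemma measure_dyadicMean_gt_le (g : E → ℝ≥0∞) (k : ℤ) (x : E) (l : ℝ≥0∞) :
    l * μ {y ∈ ball x ((2 : ℝ) ^ k) | ∃ j ≤ k, l < dyadicMean μ g j y} ≤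
      8 ^ finrank ℝ E * ∫⁻ y in ball x ((2 : ℝ) ^ (k + 1)), g y ∂μ := by
  set S := {y ∈ ball x ((2 : ℝ) ^ k) | ∃ j ≤ k, l < dyadicMean μ g j y} with hS
  let t : Set (E × ℤ) := {q | q.1 ∈ ball x ((2 : ℝ) ^ k) ∧ q.2 ≤ k ∧ l < dyadicMean μ g q.2 q.1}
  obtain ⟨u, hut, hdisj, hcov⟩ :=
    Vitali.exists_disjoint_subfamily_covering_enlargement_closedBall t (fun q => q.1)
      (fun q => (2 : ℝ) ^ q.2) ((2 : ℝ) ^ k)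
      (fun q hq => zpow_le_zpow_right₀ one_le_two hq.2.1) 4 (by norm_num)
  have hdisj' : u.PairwiseDisjoint fun q => ball q.1 ((2 : ℝ) ^ q.2) :=
    hdisj.mono fun q => ball_subset_closedBall
  have hu : u.Countable := hdisj'.countable_of_nonempty_interior fun q _ => by
    rw [isOpen_ball.interior_eq]
    exact nonempty_ball.2 (by positivity)
  have hScov : S ⊆ ⋃ q ∈ u, ball q.1 ((2 : ℝ) ^ (q.2 + 1 + 1 + 1)) := by
    rintro y ⟨hy, j, hj, hlt⟩
    obtain ⟨q, hq, hsub⟩ := hcov (y, j) ⟨hy, hj, hlt⟩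
    refine mem_biUnion hq (closedBall_subset_ball ?_ (hsub (mem_closedBall_self (by positivity))))
    have : (0 : ℝ) < 2 ^ q.2 := by positivity
    simp only [zpow_add_one₀ (two_ne_zero (α := ℝ))]
    linarith
  calc l * μ S ≤ l * ∑' q : u, μ (ball q.1.1 ((2 : ℝ) ^ (q.1.2 + 1 + 1 + 1))) := by
        gcongr
        exact (measure_mono hScov).trans (measure_biUnion_le μ hu _)
    _ = 8 ^ finrank ℝ E * ∑' q : u, l * μ (ball q.1.1 ((2 : ℝ) ^ q.1.2)) := by
        rw [← ENNReal.tsum_mul_left, ← ENNReal.tsum_mul_left]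
        congr 1
        funext q
        rw [measure_ball_dyadic_succ μ _ _ q.1.1, measure_ball_dyadic_succ μ _ _ q.1.1,
          measure_ball_dyadic_succ μ _ _ q.1.1, show (8 : ℝ≥0∞) = 2 * (2 * 2) by norm_num,
          mul_pow, mul_pow]
        ring
    _ ≤ 8 ^ finrank ℝ E * ∑' q : u, ∫⁻ y in ball q.1.1 ((2 : ℝ) ^ q.1.2), g y ∂μ := by
        gcongr with q
        rw [lintegral_ball_dyadic]
        gcongr
        exact (hut q.2).2.2.le
    _ = 8 ^ finrank ℝ E * ∫⁻ y in ⋃ q ∈ u, ball q.1 ((2 : ℝ) ^ q.2), g y ∂μ := by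
        rw [lintegral_biUnion hu (fun q _ => measurableSet_ball) hdisj']
    _ ≤ _ := by
        gcongr
        refine iUnion₂_subset fun q hq => ball_subset_ball' ?_
        have h1 : (2 : ℝ) ^ q.2 ≤ 2 ^ k := zpow_le_zpow_right₀ one_le_two (hut hq).2.1
        have h2 := (mem_ball.1 (hut hq).1)
        rw [zpow_add_one₀ two_ne_zero]
        linarith

/-- Splitting the range of `z` at the levels `2 ^ n * s`. -/
lemma rpow_le_add_tsum_dyadic_levels {θ : ℝ} (hθ : 0 < θ) {s z : ℝ≥0∞} (hs : s ≠ 0)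
    (hz : z ≠ ⊤) :
    z ^ θ ≤ s ^ θ + ∑' n : ℕ, (2 ^ (n + 1) * s) ^ θ * (if 2 ^ n * s < z then 1 else 0) := by
  classical
  by_cases hzs : z ≤ s
  · exact (ENNReal.rpow_le_rpow hzs hθ.le).trans le_self_add
  have hex : ∃ n : ℕ, z ≤ 2 ^ (n + 1) * s := by
    obtain ⟨n, hn⟩ := ENNReal.exists_nat_gt (ENNReal.div_lt_top hz hs).ne
    refine ⟨n, ?_⟩
    rw [← ENNReal.div_le_iff_le_mul (Or.inl hs) (Or.inr (by simp))]
    refine hn.le.trans ?_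
    have : n ≤ 2 ^ (n + 1) := (Nat.lt_two_pow_self.trans_le
      (Nat.pow_le_pow_right two_pos (Nat.le_succ n))).le
    exact_mod_cast this
  have hlt : 2 ^ Nat.find hex * s < z := by
    rcases h : Nat.find hex with _ | m
    · simpa using hzs
    · exact not_le.1 (Nat.find_min hex (by omega : m < Nat.find hex))
  refine le_trans ?_ le_add_self
  refine le_trans ?_ (ENNReal.le_tsum (Nat.find hex))
  rw [if_pos hlt, mul_one]
  exact ENNReal.rpow_le_rpow (Nat.find_spec hex) hθ.le

/-- The Coifman–Rochberg estimate: for `0 < θ < 1`, the mean of `(Mg) ^ θ` over a ball is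
controlled by the means of `g` over the larger concentric balls. In particular `(Mg) ^ θ` is an
`A₁` weight, and it inherits Morrey bounds from `g`. -/
theorem exists_dyadicMean_dyadicMaximal_rpow_le {θ : ℝ} (hθ : 0 < θ) (hθ1 : θ < 1) :
    ∃ C : ℝ≥0∞, C ≠ ⊤ ∧ ∀ g : E → ℝ≥0∞, Measurable g → ∀ (k : ℤ) (x : E),
      dyadicMean μ (fun y => dyadicMaximal μ g y ^ θ) k x ≤
        C * (⨆ j : ℤ, ⨆ _ : k ≤ j, dyadicMean μ g j x) ^ θ := by
  set D : ℝ≥0∞ := 2 ^ finrank ℝ E with hD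
  have hDtop : D ≠ ⊤ := by simp [hD]
  -- the ratio of the geometric series over the dyadic levels, where `θ < 1` enters
  set q : ℝ≥0∞ := 2 ^ θ / 2 with hq
  have hq1 : q < 1 := by
    rw [hq, ENNReal.div_lt_iff (Or.inl two_ne_zero) (Or.inl ENNReal.ofNat_ne_top), one_mul]
    simpa using ENNReal.rpow_lt_rpow_of_exponent_lt (x := 2) (by norm_num) (by simp) hθ1
  set G : ℝ≥0∞ := (1 - q)⁻¹ with hG
  have hGtop : G ≠ ⊤ := by simpa [hG, tsub_eq_zero_iff_le] using hq1
  set C : ℝ≥0∞ := D ^ θ + 1 + 2 ^ θ * (8 ^ finrank ℝ E * D) * G with hC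
  have h2top : (2 : ℝ≥0∞) ^ θ ≠ ⊤ := ENNReal.rpow_ne_top_of_nonneg hθ.le (by simp)
  have hCtop : C ≠ ⊤ := by
    refine ENNReal.add_ne_top.2 ⟨ENNReal.add_ne_top.2
      ⟨ENNReal.rpow_ne_top_of_nonneg hθ.le hDtop, by simp⟩, ?_⟩
    exact ENNReal.mul_ne_top (ENNReal.mul_ne_top h2top
      (ENNReal.mul_ne_top (by simp) hDtop)) hGtop
  refine ⟨C, hCtop, fun g hg k x => ?_⟩
  set S : ℝ≥0∞ := ⨆ j : ℤ, ⨆ _ : k ≤ j, dyadicMean μ g j x with hS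
  have hSle : ∀ j, k ≤ j → dyadicMean μ g j x ≤ S := fun j hj =>
    le_iSup₂_of_le j hj le_rfl
  -- balls of radius at least `2 ^ k` around points of the ball
  have hlarge : ∀ y ∈ ball x ((2 : ℝ) ^ k), ∀ j, k ≤ j → dyadicMean μ g j y ≤ D * S := by
    intro y hy j hj
    refine (dyadicMean_le_succ μ g ((mem_ball.1 hy).le.trans
      (zpow_le_zpow_right₀ one_le_two hj))).trans ?_
    gcongr
    exact hSle _ (by omega)
  have hdouble : ∫⁻ y in ball x ((2 : ℝ) ^ (k + 1)), g y ∂μ ≤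
      S * (D * μ (ball x ((2 : ℝ) ^ k))) := by
    rw [lintegral_ball_dyadic, measure_ball_dyadic_succ μ k x x]
    gcongr
    exact hSle _ (by omega)
  have hsmall : ∀ y ∈ ball x ((2 : ℝ) ^ k), ∀ j ≤ k, dyadicMean μ g j y ≤
      (S * (D * μ (ball x ((2 : ℝ) ^ k)))) / μ (ball y ((2 : ℝ) ^ j)) := by
    intro y hy j hj
    rw [dyadicMean_eq]
    gcongr
    refine (lintegral_mono_set (ball_subset_ball' ?_)).trans hdouble
    have h1 : (2 : ℝ) ^ j ≤ 2 ^ k := zpow_le_zpow_right₀ one_le_two hj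
    have h2 := (mem_ball.1 hy)
    rw [zpow_add_one₀ two_ne_zero]
    linarith
  by_cases hStop : S = ⊤
  · have : C ≠ 0 := by simp [hC]
    rw [hStop, ENNReal.top_rpow_of_pos hθ, ENNReal.mul_top this]
    exact le_top
  have hBtop : μ (ball x ((2 : ℝ) ^ k)) ≠ ⊤ := measure_ball_lt_top.ne
  rw [dyadicMean_eq]
  refine ENNReal.div_le_of_le_mul ?_
  by_cases hS0 : S = 0
  · have : ∀ y ∈ ball x ((2 : ℝ) ^ k), dyadicMaximal μ g y ^ θ = 0 := by
      intro y hy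
      have : dyadicMaximal μ g y = 0 := by
        refine le_antisymm (iSup_le fun j => ?_) bot_le
        rcases le_total k j with hj | hj
        · simpa [hS0] using hlarge y hy j hj
        · simpa [hS0] using hsmall y hy j hj
      rw [this, ENNReal.zero_rpow_of_pos hθ]
    rw [setLIntegral_congr_fun measurableSet_ball this]
    simp
  set F : ℕ → Set E := fun n =>
    {y ∈ ball x ((2 : ℝ) ^ k) | ∃ j ≤ k, 2 ^ n * S < dyadicMean μ g j y} with hF
  have hFm : ∀ n, MeasurableSet (F n) := by
    intro n
    have : F n = ball x ((2 : ℝ) ^ k) ∩ ⋃ j : ℤ, ⋃ _ : j ≤ k,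
        {y | 2 ^ n * S < dyadicMean μ g j y} := by
      ext y
      simp [hF]
    rw [this]
    exact measurableSet_ball.inter (MeasurableSet.iUnion fun j => MeasurableSet.iUnion fun _ =>
      measurableSet_lt measurable_const (measurable_dyadicMean μ hg j))
  have hpt : ∀ y ∈ ball x ((2 : ℝ) ^ k), dyadicMaximal μ g y ^ θ ≤
      (D ^ θ * S ^ θ + S ^ θ) +
        ∑' n : ℕ, (2 ^ (n + 1) * S) ^ θ * (F n).indicator (fun _ => 1) y := by
    intro y hy
    rw [← ENNReal.le_rpow_inv_iff hθ]
    refine iSup_le fun j => ?_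
    rw [ENNReal.le_rpow_inv_iff hθ]
    rcases le_total k j with hj | hj
    · refine (ENNReal.rpow_le_rpow (hlarge y hy j hj) hθ.le).trans ?_
      rw [ENNReal.mul_rpow_of_nonneg _ _ hθ.le, add_assoc]
      exact le_self_add
    · refine (rpow_le_add_tsum_dyadic_levels hθ hS0 ?_).trans ?_
      · refine ne_top_of_le_ne_top ?_ (hsmall y hy j hj)
        exact (ENNReal.div_lt_top (ENNReal.mul_ne_top hStop (ENNReal.mul_ne_top hDtop hBtop))
          (measure_ball_dyadic_pos μ j y)).ne
      · gcongr with n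
        · exact le_add_self
        · split_ifs with h
          · rw [indicator_of_mem]
            exact ⟨hy, j, hj, h⟩
          · exact bot_le
  have hFle : ∀ n, μ (F n) ≤ (8 ^ finrank ℝ E * D) * μ (ball x ((2 : ℝ) ^ k)) / 2 ^ n := by
    intro n
    have h := (measure_dyadicMean_gt_le μ g k x (2 ^ n * S)).trans
      (mul_le_mul_right hdouble _)
    rw [ENNReal.le_div_iff_mul_le (by simp) (by simp)]
    rw [← ENNReal.mul_le_mul_iff_right hS0 hStop]
    calc S * (μ (F n) * 2 ^ n) = 2 ^ n * S * μ (F n) := by ring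
      _ ≤ _ := h
      _ = _ := by ring
  calc ∫⁻ y in ball x ((2 : ℝ) ^ k), dyadicMaximal μ g y ^ θ ∂μ
      ≤ ∫⁻ y in ball x ((2 : ℝ) ^ k), ((D ^ θ * S ^ θ + S ^ θ) +
        ∑' n : ℕ, (2 ^ (n + 1) * S) ^ θ * (F n).indicator (fun _ => 1) y) ∂μ :=
        setLIntegral_mono' measurableSet_ball hpt
    _ = (D ^ θ * S ^ θ + S ^ θ) * μ (ball x ((2 : ℝ) ^ k)) +
        ∑' n : ℕ, (2 ^ (n + 1) * S) ^ θ * μ (F n) := by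
        rw [lintegral_add_left measurable_const, setLIntegral_const, lintegral_tsum]
        · congr 2
          funext n
          rw [lintegral_const_mul _ (measurable_const.indicator (hFm n)),
            lintegral_indicator (hFm n), setLIntegral_one, Measure.restrict_apply (hFm n)]
          congr 2
          exact inter_eq_left.2 fun y hy => hy.1
        · exact fun n => ((measurable_const.indicator (hFm n)).const_mul _).aemeasurable
    _ ≤ (D ^ θ * S ^ θ + S ^ θ) * μ (ball x ((2 : ℝ) ^ k)) +
        ∑' n : ℕ, (2 ^ θ * (8 ^ finrank ℝ E * D) * S ^ θ * μ (ball x ((2 : ℝ) ^ k))) * q ^ n := by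
        refine add_le_add_right (ENNReal.tsum_le_tsum fun n => ?_) _
        calc (2 ^ (n + 1) * S) ^ θ * μ (F n) ≤ (2 ^ (n + 1) * S) ^ θ *
              ((8 ^ finrank ℝ E * D) * μ (ball x ((2 : ℝ) ^ k)) / 2 ^ n) := by
              gcongr
              exact hFle n
          _ = _ := by
            rw [ENNReal.mul_rpow_of_nonneg _ _ hθ.le, ← ENNReal.rpow_natCast 2 (n + 1),
              ← ENNReal.rpow_mul, mul_comm ((n + 1 : ℕ) : ℝ) θ, ENNReal.rpow_mul,
              ENNReal.rpow_natCast, hq, pow_succ, div_eq_mul_inv, div_eq_mul_inv, mul_pow,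
              ENNReal.inv_pow]
            ring
    _ = C * S ^ θ * μ (ball x ((2 : ℝ) ^ k)) := by
        rw [ENNReal.tsum_mul_left, ENNReal.tsum_geometric, ← hG, hC]
        ring

/-- A function is dominated by its maximal function, by Lebesgue differentiation. -/
lemma ae_le_dyadicMaximal [Nontrivial E] {g : E → ℝ≥0∞} (hg : Measurable g)
    (hfin : ∀ (k : ℤ) (x : E), dyadicMean μ g k x ≠ ⊤) :
    ∀ᵐ x ∂μ, g x ≤ dyadicMaximal μ g x := by
  have hloc : IsLocallyFiniteMeasure (μ.withDensity g) := by
    refine ⟨fun x => ⟨ball x ((2 : ℝ) ^ (0 : ℤ)), ball_mem_nhds _ (by positivity), ?_⟩⟩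
    rw [withDensity_apply _ measurableSet_ball, lintegral_ball_dyadic]
    exact ENNReal.mul_lt_top (hfin _ _).lt_top measure_ball_lt_top
  filter_upwards [Besicovitch.ae_tendsto_rnDeriv (μ.withDensity g) μ,
    Measure.rnDeriv_withDensity μ hg] with x hx hx'
  rw [hx'] at hx
  have hlim : Tendsto (fun n : ℕ => (2 : ℝ) ^ (-(n : ℤ))) atTop (𝓝[>] 0) := by
    refine tendsto_nhdsWithin_iff.2 ⟨?_, Eventually.of_forall fun n => by
      simp only [mem_Ioi]; positivity⟩
    have := tendsto_pow_atTop_nhds_zero_of_lt_one (r := (2 : ℝ)⁻¹) (by norm_num) (by norm_num)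
    simpa using this
  refine le_of_tendsto (hx.comp hlim) (Eventually.of_forall fun n => ?_)
  have hae : closedBall x ((2 : ℝ) ^ (-(n : ℤ))) =ᵐ[μ] ball x ((2 : ℝ) ^ (-(n : ℤ))) := by
    refine (ae_eq_of_subset_of_measure_ge ball_subset_closedBall
      (Measure.addHaar_closedBall_eq_addHaar_ball μ x _).le
      measurableSet_ball.nullMeasurableSet measure_closedBall_lt_top.ne).symm
  refine le_trans (le_of_eq ?_) (dyadicMean_le_dyadicMaximal μ g (-(n : ℤ)) x)
  rw [dyadicMean_eq, Function.comp_apply, withDensity_apply _ measurableSet_closedBall,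
    setLIntegral_congr hae, measure_congr hae]

end DyadicMeans

/-! ### Riesz potentials -/

section RieszPotential

open Metric Set Filter Module
open scoped ENNReal Topology

/-- The Hedberg-type sum behind the pointwise bounds of Riesz potentials: the two bounds of the
minimum balance at the scale where `y ^ k` is about `A / V`, away from which the sum is
geometric. -/
lemma exists_tsum_zpow_mul_min_le {y : ℝ≥0∞} (hy : 1 < y) (hy' : y ≠ ⊤) {t : ℝ} (ht : 1 < t) :
    ∃ C : ℝ≥0∞, C ≠ ⊤ ∧ ∀ A V : ℝ≥0∞, A ≠ 0 → A ≠ ⊤ →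
      ∑' k : ℤ, y ^ k * min (V ^ t) ((A * (y ^ k)⁻¹) ^ t) ≤ C * A * V ^ (t - 1) := by
  have ht0 : 0 < t := by linarith
  have ht1 : 0 < t - 1 := by linarith
  have hy0 : y ≠ 0 := (zero_lt_one.trans hy).ne'
  set q : ℝ≥0∞ := y⁻¹ with hq
  have hq1 : q < 1 := ENNReal.inv_lt_one.2 hy
  set q' : ℝ≥0∞ := q ^ (t - 1) with hq'
  have hq1' : q' < 1 := ENNReal.rpow_lt_one hq1 ht1
  set C : ℝ≥0∞ := (1 - q')⁻¹ + (1 - q)⁻¹ with hC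
  have hCtop : C ≠ ⊤ := by
    refine ENNReal.add_ne_top.2 ⟨?_, ?_⟩ <;> simpa [tsub_eq_zero_iff_le]
  have hC0 : C ≠ 0 := by simp [hC]
  refine ⟨C, hCtop, fun A V hA hA' => ?_⟩
  rcases eq_or_ne V 0 with rfl | hV
  · simp [ENNReal.zero_rpow_of_pos ht0]
  rcases eq_or_ne V ⊤ with rfl | hV'
  · rw [ENNReal.top_rpow_of_pos ht1, ENNReal.mul_top (mul_ne_zero hC0 hA)]
    exact le_top
  obtain ⟨m, hm, hm'⟩ := ENNReal.exists_mem_Ico_zpow (x := A / V) (by simp [hA, hV'])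
    (ENNReal.div_lt_top hA' hV).ne hy hy'
  -- recentre the sum at the balancing scale `m` and split it there
  rw [← (Equiv.addLeft (m + 1)).tsum_eq, tsum_of_nat_of_neg_add_one ENNReal.summable
    ENNReal.summable, hC, add_mul, add_mul, ← ENNReal.tsum_geometric, ← ENNReal.tsum_geometric,
    mul_assoc, mul_assoc, ← ENNReal.tsum_mul_right, ← ENNReal.tsum_mul_right]
  refine add_le_add (ENNReal.tsum_le_tsum fun n => ?_) (ENNReal.tsum_le_tsum fun n => ?_)
  · set k : ℤ := (Equiv.addLeft (m + 1)) (n : ℤ) with hk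
    have hk' : y ^ k = y ^ (m + 1) * y ^ n := by
      rw [hk, Equiv.coe_addLeft, ENNReal.zpow_add hy0 hy', zpow_natCast]
    have hyk0 : y ^ k ≠ 0 := (ENNReal.zpow_pos hy0 hy' k).ne'
    have hyk : y ^ k ≠ ⊤ := ENNReal.zpow_ne_top hy0 hy' k
    have hle : A * (y ^ k)⁻¹ ≤ V * q ^ n := by
      have h1 : A ≤ V * y ^ (m + 1) := by
        rw [mul_comm]
        exact (ENNReal.div_le_iff hV hV').1 hm'.le
      have h2 : y ^ (m + 1) ≠ 0 := (ENNReal.zpow_pos hy0 hy' _).ne'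
      have h3 : y ^ (m + 1) ≠ ⊤ := ENNReal.zpow_ne_top hy0 hy' _
      calc A * (y ^ k)⁻¹ ≤ V * y ^ (m + 1) * (y ^ k)⁻¹ := by gcongr
        _ = V * (y ^ (m + 1) * (y ^ (m + 1))⁻¹) * q ^ n := by
          rw [hk', ENNReal.mul_inv (Or.inl h2) (Or.inl h3), hq, ENNReal.inv_pow]
          ring
        _ = V * q ^ n := by rw [ENNReal.mul_inv_cancel h2 h3, mul_one]
    calc y ^ k * min (V ^ t) ((A * (y ^ k)⁻¹) ^ t)
        ≤ y ^ k * (A * (y ^ k)⁻¹) ^ t := by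
          gcongr
          exact min_le_right _ _
      _ = y ^ k * (A * (y ^ k)⁻¹) * (A * (y ^ k)⁻¹) ^ (t - 1) := by
          rw [mul_assoc]
          congr 1
          nth_rw 2 [← ENNReal.rpow_one (A * (y ^ k)⁻¹)]
          rw [← ENNReal.rpow_add_of_nonneg _ _ zero_le_one ht1.le, add_sub_cancel]
      _ = A * (A * (y ^ k)⁻¹) ^ (t - 1) := by
          congr 1
          rw [mul_left_comm, ENNReal.mul_inv_cancel hyk0 hyk, mul_one]
      _ ≤ A * (V * q ^ n) ^ (t - 1) := by gcongr
      _ = q' ^ n * (A * V ^ (t - 1)) := by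
          rw [ENNReal.mul_rpow_of_nonneg _ _ ht1.le, hq', ← ENNReal.rpow_natCast,
            ← ENNReal.rpow_natCast, ← ENNReal.rpow_mul, ← ENNReal.rpow_mul, mul_comm (n : ℝ)]
          ring
  · set k : ℤ := (Equiv.addLeft (m + 1)) (-((n : ℤ) + 1)) with hk
    have hk' : y ^ k = y ^ m * q ^ n := by
      have : k = m + -(n : ℤ) := by
        rw [hk, Equiv.coe_addLeft]
        ring
      rw [this, ENNReal.zpow_add hy0 hy', ENNReal.zpow_neg, zpow_natCast, hq, ENNReal.inv_pow]
    calc y ^ k * min (V ^ t) ((A * (y ^ k)⁻¹) ^ t)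
        ≤ (A / V * q ^ n) * V ^ t := by
          rw [hk']
          gcongr
          exact min_le_left _ _
      _ = q ^ n * (A * V ^ (t - 1)) := by
          rw [ENNReal.rpow_sub _ _ hV hV', ENNReal.rpow_one, div_eq_mul_inv, div_eq_mul_inv]
          ring

variable {E : Type*} [NormedAddCommGroup E] [NormedSpace ℝ E] [FiniteDimensional ℝ E]
  [MeasurableSpace E] [BorelSpace E] (μ : Measure E) [μ.IsAddHaarMeasure]

/-- The Riesz potential `∫ |x - y| ^ (α - n) f y dy` of a nonnegative function, where `n` is the
dimension, without the usual normalizing constant. For `α < n` the kernel has the junk value `0` at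
`y = x`, which is a null set when `0 < n`. -/
noncomputable def rieszPotential (α : ℝ) (f : E → ℝ≥0∞) (x : E) : ℝ≥0∞ :=
  ∫⁻ y, ENNReal.ofReal (‖x - y‖ ^ (α - finrank ℝ E)) * f y ∂μ

lemma measurable_rieszKernel (α : ℝ) :
    Measurable fun q : E × E => ENNReal.ofReal (‖q.1 - q.2‖ ^ (α - finrank ℝ E)) := by
  fun_prop

lemma measurable_rieszPotential (α : ℝ) {f : E → ℝ≥0∞} (hf : Measurable f) :
    Measurable (rieszPotential μ α f) :=
  ((measurable_rieszKernel α).mul (hf.comp measurable_snd)).lintegral_prod_right'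

lemma lintegral_mul_rieszPotential_comm (α : ℝ) {f g : E → ℝ≥0∞} (hf : Measurable f)
    (hg : Measurable g) :
    ∫⁻ x, f x * rieszPotential μ α g x ∂μ = ∫⁻ x, g x * rieszPotential μ α f x ∂μ := by
  have hK := measurable_rieszKernel (E := E) α
  simp only [rieszPotential]
  calc ∫⁻ x, f x * ∫⁻ y, ENNReal.ofReal (‖x - y‖ ^ (α - finrank ℝ E)) * g y ∂μ ∂μ
      = ∫⁻ x, ∫⁻ y, f x * (ENNReal.ofReal (‖x - y‖ ^ (α - finrank ℝ E)) * g y) ∂μ ∂μ := by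
        congr 1
        funext x
        exact (lintegral_const_mul (f x) (by fun_prop)).symm
    _ = ∫⁻ y, ∫⁻ x, f x * (ENNReal.ofReal (‖x - y‖ ^ (α - finrank ℝ E)) * g y) ∂μ ∂μ :=
        lintegral_lintegral_swap ((hf.comp measurable_fst).mul
          (hK.mul (hg.comp measurable_snd))).aemeasurable
    _ = _ := by
        congr 1
        funext y
        refine Eq.trans ?_ (lintegral_const_mul (g y) (by fun_prop))
        congr 1
        funext x
        rw [norm_sub_rev]
        ring

lemma exists_rieszPotential_le_tsum {α : ℝ} (hαn : α < finrank ℝ E) :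
    ∃ C : ℝ≥0∞, C ≠ ⊤ ∧ ∀ f : E → ℝ≥0∞, Measurable f → ∀ x,
      rieszPotential μ α f x ≤ C * ∑' k : ℤ, ((2 : ℝ≥0∞) ^ α) ^ k * dyadicMean μ f k x := by
  set n : ℝ := (finrank ℝ E : ℝ) with hn
  refine ⟨2 ^ (n - α) * μ (ball 0 1), ENNReal.mul_ne_top
    (ENNReal.rpow_ne_top_of_nonneg (by linarith) (by simp)) measure_ball_lt_top.ne,
    fun f hf x => ?_⟩
  set C : ℝ≥0∞ := 2 ^ (n - α) * μ (ball 0 1) with hC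
  have hker : ∀ y, ENNReal.ofReal (‖x - y‖ ^ (α - n)) ≤ C * ∑' k : ℤ, ((2 : ℝ≥0∞) ^ α) ^ k *
      (μ (ball x ((2 : ℝ) ^ k)))⁻¹ * (ball x ((2 : ℝ) ^ k)).indicator (fun _ => 1) y := by
    intro y
    rcases eq_or_ne x y with rfl | hxy
    -- on the diagonal the kernel is `0`, the value of a negative real power at `0`
    · have : α - n ≠ 0 := by linarith
      simp [Real.zero_rpow this]
    have hz : 0 < ‖x - y‖ := norm_pos_iff.2 (sub_ne_zero.2 hxy)
    obtain ⟨k, hk, hk'⟩ := exists_mem_Ico_zpow hz one_lt_two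
    have hmem : y ∈ ball x ((2 : ℝ) ^ (k + 1)) := by
      rwa [mem_ball, dist_comm, dist_eq_norm]
    calc ENNReal.ofReal (‖x - y‖ ^ (α - n)) ≤ ENNReal.ofReal (((2 : ℝ) ^ k) ^ (α - n)) :=
          ENNReal.ofReal_le_ofReal
            (Real.rpow_le_rpow_of_nonpos (by positivity) hk (by linarith))
      _ = (2 : ℝ≥0∞) ^ ((k : ℝ) * (α - n)) := by
          rw [← Real.rpow_intCast, ← Real.rpow_mul zero_le_two,
            ← ENNReal.ofReal_rpow_of_pos two_pos]
          simp
      _ = C * (((2 : ℝ≥0∞) ^ α) ^ (k + 1) * (μ (ball x ((2 : ℝ) ^ (k + 1))))⁻¹ *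
          (ball x ((2 : ℝ) ^ (k + 1))).indicator (fun _ => 1) y) := by
          have hb0 : μ (ball (0 : E) 1) ≠ 0 := (measure_ball_pos μ _ one_pos).ne'
          have hbt : μ (ball (0 : E) 1) ≠ ⊤ := measure_ball_lt_top.ne
          have hvol : μ (ball x ((2 : ℝ) ^ (k + 1))) =
              2 ^ (((k + 1 : ℤ) : ℝ) * n) * μ (ball 0 1) := by
            rw [Measure.addHaar_ball_of_pos μ x (by positivity)]
            congr 1
            rw [← Real.rpow_natCast, ← Real.rpow_intCast, ← Real.rpow_mul zero_le_two,
              ← ENNReal.ofReal_rpow_of_pos two_pos]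
            simp [hn]
          have h2 : (2 : ℝ≥0∞) ^ (((k + 1 : ℤ) : ℝ) * n) ≠ 0 := by simp
          have h2' : (2 : ℝ≥0∞) ^ (((k + 1 : ℤ) : ℝ) * n) ≠ ⊤ := by simp
          rw [indicator_of_mem hmem, mul_one, hvol, ENNReal.mul_inv (Or.inl h2) (Or.inl h2'), hC,
            ← ENNReal.rpow_neg, ← ENNReal.rpow_intCast, ← ENNReal.rpow_mul]
          calc (2 : ℝ≥0∞) ^ ((k : ℝ) * (α - n))
              = 2 ^ (n - α) * (2 ^ (α * ((k + 1 : ℤ) : ℝ)) *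
                2 ^ (-(((k + 1 : ℤ) : ℝ) * n))) := by
                rw [← ENNReal.rpow_add _ _ two_ne_zero (by simp),
                  ← ENNReal.rpow_add _ _ two_ne_zero (by simp)]
                congr 1
                push_cast
                ring
            _ = 2 ^ (n - α) * (2 ^ (α * ((k + 1 : ℤ) : ℝ)) *
                2 ^ (-(((k + 1 : ℤ) : ℝ) * n))) * (μ (ball 0 1) * (μ (ball (0 : E) 1))⁻¹) := by
                rw [ENNReal.mul_inv_cancel hb0 hbt, mul_one]
            _ = _ := by ring
      _ ≤ _ := by
          gcongr
          exact ENNReal.le_tsum (f := fun k : ℤ => ((2 : ℝ≥0∞) ^ α) ^ k *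
            (μ (ball x ((2 : ℝ) ^ k)))⁻¹ * (ball x ((2 : ℝ) ^ k)).indicator (fun _ => 1) y) (k + 1)
  calc rieszPotential μ α f x
      ≤ ∫⁻ y, C * ∑' k : ℤ, ((2 : ℝ≥0∞) ^ α) ^ k * (μ (ball x ((2 : ℝ) ^ k)))⁻¹ *
          (ball x ((2 : ℝ) ^ k)).indicator f y ∂μ := by
        refine lintegral_mono fun y => ?_
        refine (mul_le_mul_left (hker y) (f y)).trans (le_of_eq ?_)
        rw [mul_assoc, ← ENNReal.tsum_mul_right]
        congr 2
        funext k
        rw [mul_assoc]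
        congr 1
        by_cases h : y ∈ ball x ((2 : ℝ) ^ k) <;> simp [h]
    _ = _ := by
        have hm : ∀ k : ℤ, Measurable ((ball x ((2 : ℝ) ^ k)).indicator f) :=
          fun k => hf.indicator measurableSet_ball
        rw [lintegral_const_mul _ (Measurable.tsum fun k => (hm k).const_mul _),
          lintegral_tsum fun k => ((hm k).const_mul _).aemeasurable]
        congr 2
        funext k
        rw [lintegral_const_mul _ (hm k), lintegral_indicator measurableSet_ball, dyadicMean_eq,
          div_eq_mul_inv]
        ring

/-- The step from functions to weights in the Schur test: Hölder's inequality with respect to the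
measure `|x - y| ^ (α - n) dy`. -/
lemma rieszPotential_rpow_le {α r : ℝ} (hr : 1 < r) {f w : E → ℝ≥0∞} (hf : Measurable f)
    (hw : Measurable w) (hw0 : ∀ᵐ x ∂μ, w x ≠ 0 ∧ w x ≠ ⊤) (x : E) :
    rieszPotential μ α f x ^ r ≤
      rieszPotential μ α (fun y => f y ^ r * w y ^ (-(r - 1))) x *
        rieszPotential μ α w x ^ (r - 1) := by
  have hr0 : 0 < r := by linarith
  have hpq : r.HolderConjugate (r / (r - 1)) := Real.HolderConjugate.conjExponent hr
  have hr1 : 0 < r - 1 := by linarith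
  set K : E → ℝ≥0∞ := fun y => ENNReal.ofReal (‖x - y‖ ^ (α - finrank ℝ E)) with hK
  have hKm : Measurable K := by fun_prop
  have hpot : ∀ g : E → ℝ≥0∞, Measurable g →
      rieszPotential μ α g x = ∫⁻ y, g y ∂(μ.withDensity K) := by
    intro g hg
    rw [lintegral_withDensity_eq_lintegral_mul _ hKm hg]
    rfl
  have hac : ∀ᵐ y ∂(μ.withDensity K), w y ≠ 0 ∧ w y ≠ ⊤ :=
    (withDensity_absolutelyContinuous μ K).ae_le hw0
  -- `s` is the reciprocal of the exponent conjugate to `r`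
  set s : ℝ := (r - 1) / r with hs
  have hs0 : 0 < s := by positivity
  rw [hpot f hf, hpot w hw, hpot (fun y => f y ^ r * w y ^ (-(r - 1))) (by fun_prop)]
  have hH := ENNReal.lintegral_mul_le_Lp_mul_Lq (μ.withDensity K) hpq
    (f := fun y => f y * w y ^ (-s)) (g := fun y => w y ^ s)
    (hf.mul (hw.pow_const _)).aemeasurable (hw.pow_const _).aemeasurable
  have e1 : ∫⁻ y, ((fun y => f y * w y ^ (-s)) * fun y => w y ^ s) y ∂(μ.withDensity K) =
      ∫⁻ y, f y ∂(μ.withDensity K) := by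
    refine lintegral_congr_ae ?_
    filter_upwards [hac] with y hy
    simp only [Pi.mul_apply]
    rw [mul_assoc, ← ENNReal.rpow_add _ _ hy.1 hy.2, neg_add_cancel, ENNReal.rpow_zero, mul_one]
  have e2 : ∀ y, (f y * w y ^ (-s)) ^ r = f y ^ r * w y ^ (-(r - 1)) := by
    intro y
    rw [ENNReal.mul_rpow_of_nonneg _ _ hr0.le, ← ENNReal.rpow_mul]
    congr 2
    rw [hs]
    field_simp
  have e3 : ∀ y, (w y ^ s) ^ (r / (r - 1)) = w y := by
    intro y
    rw [← ENNReal.rpow_mul, show s * (r / (r - 1)) = 1 by rw [hs]; field_simp, ENNReal.rpow_one]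
  rw [e1] at hH
  simp only [e2, e3] at hH
  refine (ENNReal.rpow_le_rpow hH hr0.le).trans (le_of_eq ?_)
  rw [ENNReal.mul_rpow_of_nonneg _ _ hr0.le, ← ENNReal.rpow_mul, ← ENNReal.rpow_mul,
    show 1 / r * r = 1 by field_simp, ENNReal.rpow_one,
    show 1 / (r / (r - 1)) * r = r - 1 by field_simp]

end RieszPotential

/-! ### The trace inequality for Morrey weights -/

section TraceInequality

open Metric Set Filter Module
open scoped ENNReal Topology

variable {E : Type*} [NormedAddCommGroup E] [NormedSpace ℝ E] [FiniteDimensional ℝ E]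
  [MeasurableSpace E] [BorelSpace E] (μ : Measure E) [μ.IsAddHaarMeasure]

/-- The Morrey condition on dyadic balls, in the form `⨍_B b ^ p ≤ (A * 2 ^ (-k * α)) ^ p` for
balls `B` of radius `2 ^ k`. -/
def DyadicMorrey (α p : ℝ) (A : ℝ≥0∞) (b : E → ℝ≥0∞) : Prop :=
  ∀ (k : ℤ) (x : E), dyadicMean μ (fun y => b y ^ p) k x ≤ (A * (((2 : ℝ≥0∞) ^ α) ^ k)⁻¹) ^ p

/-- The function `(M (b ^ p)) ^ (1 / p)`, which dominates `b` and has better properties: its powers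
of exponent less than `p` are `A₁` weights with the Morrey bounds of `b`. -/
noncomputable def maximalMajorant (p : ℝ) (b : E → ℝ≥0∞) (x : E) : ℝ≥0∞ :=
  dyadicMaximal μ (fun y => b y ^ p) x ^ (1 / p)

lemma measurable_maximalMajorant (p : ℝ) {b : E → ℝ≥0∞} (hb : Measurable b) :
    Measurable (maximalMajorant μ p b) :=
  (measurable_dyadicMaximal μ (hb.pow_const p)).pow_const _

lemma ae_le_maximalMajorant [Nontrivial E] {α p : ℝ} (hp : 0 < p) {A : ℝ≥0∞} (hA : A ≠ ⊤)
    {b : E → ℝ≥0∞} (hb : Measurable b) (hM : DyadicMorrey μ α p A b) :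
    ∀ᵐ x ∂μ, b x ≤ maximalMajorant μ p b x := by
  filter_upwards [ae_le_dyadicMaximal μ (hb.pow_const p) fun k x =>
    ne_top_of_le_ne_top (ENNReal.rpow_ne_top_of_nonneg hp.le (ENNReal.mul_ne_top hA
      (ENNReal.inv_ne_top.2 (ENNReal.zpow_pos (by simp) (by simp) k).ne'))) (hM k x)] with x hx
  rw [maximalMajorant, one_div, ENNReal.le_rpow_inv_iff hp]
  exact hx

lemma exists_dyadicMean_maximalMajorant_rpow_le {α : ℝ} (hα : 0 < α) {p t : ℝ} (ht : 0 < t)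
    (htp : t < p) :
    ∃ C : ℝ≥0∞, C ≠ ⊤ ∧ ∀ (A : ℝ≥0∞) (b : E → ℝ≥0∞), Measurable b → DyadicMorrey μ α p A b →
      ∀ (k : ℤ) (x : E), dyadicMean μ (fun y => maximalMajorant μ p b y ^ t) k x ≤
        C * min (maximalMajorant μ p b x ^ t) ((A * (((2 : ℝ≥0∞) ^ α) ^ k)⁻¹) ^ t) := by
  have hp : 0 < p := ht.trans htp
  have hθ : 0 < t / p := by positivity
  obtain ⟨C, hC, h⟩ := exists_dyadicMean_dyadicMaximal_rpow_le μ hθ ((div_lt_one hp).2 htp)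
  refine ⟨C, hC, fun A b hb hM k x => ?_⟩
  have e : ∀ y, maximalMajorant μ p b y ^ t = dyadicMaximal μ (fun y => b y ^ p) y ^ (t / p) := by
    intro y
    rw [maximalMajorant, ← ENNReal.rpow_mul]
    congr 1
    ring
  simp only [e]
  refine (h _ (hb.pow_const p) k x).trans ?_
  gcongr
  refine le_min ?_ ?_
  · gcongr
    exact iSup₂_le fun j _ => dyadicMean_le_dyadicMaximal μ _ j x
  · calc (⨆ j : ℤ, ⨆ _ : k ≤ j, dyadicMean μ (fun y => b y ^ p) j x) ^ (t / p)
        ≤ ((A * (((2 : ℝ≥0∞) ^ α) ^ k)⁻¹) ^ p) ^ (t / p) := by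
          gcongr
          refine iSup₂_le fun j hj => (hM j x).trans ?_
          gcongr
          exact (ENNReal.one_lt_rpow ENNReal.one_lt_two hα).le
      _ = _ := by
          rw [← ENNReal.rpow_mul]
          congr 1
          field_simp

lemma exists_rieszPotential_maximalMajorant_rpow_le {α : ℝ} (hα : 0 < α) (hαn : α < finrank ℝ E)
    {p t : ℝ} (ht : 1 < t) (htp : t < p) :
    ∃ C : ℝ≥0∞, C ≠ ⊤ ∧ ∀ A : ℝ≥0∞, A ≠ 0 → A ≠ ⊤ → ∀ b : E → ℝ≥0∞, Measurable b →
      DyadicMorrey μ α p A b → ∀ x : E,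
        rieszPotential μ α (fun y => maximalMajorant μ p b y ^ t) x ≤
          C * A * maximalMajorant μ p b x ^ (t - 1) := by
  obtain ⟨C₁, hC₁, h₁⟩ := exists_rieszPotential_le_tsum μ hαn
  obtain ⟨C₂, hC₂, h₂⟩ := exists_dyadicMean_maximalMajorant_rpow_le μ hα
    (zero_lt_one.trans ht) htp
  obtain ⟨C₃, hC₃, h₃⟩ := exists_tsum_zpow_mul_min_le (y := (2 : ℝ≥0∞) ^ α)
    (ENNReal.one_lt_rpow ENNReal.one_lt_two hα) (by simp) ht
  refine ⟨C₁ * (C₂ * C₃), ENNReal.mul_ne_top hC₁ (ENNReal.mul_ne_top hC₂ hC₃),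
    fun A hA hA' b hb hM x => ?_⟩
  calc rieszPotential μ α (fun y => maximalMajorant μ p b y ^ t) x
      ≤ C₁ * ∑' k : ℤ, ((2 : ℝ≥0∞) ^ α) ^ k *
          dyadicMean μ (fun y => maximalMajorant μ p b y ^ t) k x :=
        h₁ _ ((measurable_maximalMajorant μ p hb).pow_const t) x
    _ ≤ C₁ * ∑' k : ℤ, C₂ * (((2 : ℝ≥0∞) ^ α) ^ k *
          min (maximalMajorant μ p b x ^ t) ((A * (((2 : ℝ≥0∞) ^ α) ^ k)⁻¹) ^ t)) := by
        refine mul_le_mul_right (ENNReal.tsum_le_tsum fun k => ?_) _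
        rw [mul_left_comm]
        gcongr
        exact h₂ A b hb hM k x
    _ ≤ C₁ * (C₂ * (C₃ * A * maximalMajorant μ p b x ^ (t - 1))) := by
        rw [ENNReal.tsum_mul_left]
        gcongr
        exact h₃ A _ hA hA'
    _ = _ := by ring

lemma ae_eq_zero_of_maximalMajorant_eq_zero {p : ℝ} (hp : 0 < p) {b : E → ℝ≥0∞}
    (hb : Measurable b) {x : E} (hx : maximalMajorant μ p b x = 0) : ∀ᵐ y ∂μ, b y = 0 := by
  have h0 : dyadicMaximal μ (fun y => b y ^ p) x = 0 := by
    rwa [maximalMajorant, ENNReal.rpow_eq_zero_iff_of_pos (by positivity)] at hx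
  have hball : ∀ k : ℕ, ∀ᵐ y ∂μ, y ∈ ball x ((2 : ℝ) ^ (k : ℤ)) → b y = 0 := by
    intro k
    have : ∫⁻ y in ball x ((2 : ℝ) ^ (k : ℤ)), b y ^ p ∂μ = 0 := by
      rw [lintegral_ball_dyadic]
      have : dyadicMean μ (fun y => b y ^ p) k x = 0 :=
        le_antisymm ((dyadicMean_le_dyadicMaximal μ _ _ x).trans h0.le) bot_le
      rw [this, zero_mul]
    rw [lintegral_eq_zero_iff (hb.pow_const p)] at this
    filter_upwards [(ae_restrict_iff' measurableSet_ball).1 this] with y hy hmem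
    have := hy hmem
    simpa [hp, hp.not_gt] using this
  filter_upwards [ae_all_iff.2 hball] with y hy
  obtain ⟨k, hk⟩ := pow_unbounded_of_one_lt (dist y x) one_lt_two
  exact hy k (by simpa using hk)

lemma ae_maximalMajorant_ne_top {α : ℝ} (hα : 0 < α) {p : ℝ} (hp : 0 < p) {A : ℝ≥0∞} (hA : A ≠ ⊤)
    {b : E → ℝ≥0∞} (hb : Measurable b) (hM : DyadicMorrey μ α p A b) :
    ∀ᵐ y ∂μ, maximalMajorant μ p b y ≠ ⊤ := by
  have hp2 : 0 < p / 2 := by positivity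
  obtain ⟨C, hC, h⟩ := exists_dyadicMean_maximalMajorant_rpow_le μ hα hp2 (half_lt_self hp)
  have hm := (measurable_maximalMajorant μ p hb).pow_const (p / 2)
  have hball : ∀ k : ℕ, ∀ᵐ y ∂μ, y ∈ ball (0 : E) ((2 : ℝ) ^ (k : ℤ)) →
      maximalMajorant μ p b y ≠ ⊤ := by
    intro k
    have : ∫⁻ y in ball (0 : E) ((2 : ℝ) ^ (k : ℤ)), maximalMajorant μ p b y ^ (p / 2) ∂μ ≠ ⊤ := by
      rw [lintegral_ball_dyadic]
      refine ENNReal.mul_ne_top (ne_top_of_le_ne_top ?_ (h A b hb hM k 0)) measure_ball_lt_top.ne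
      refine ENNReal.mul_ne_top hC (ne_top_of_le_ne_top ?_ (min_le_right _ _))
      exact ENNReal.rpow_ne_top_of_nonneg hp2.le (ENNReal.mul_ne_top hA
        (ENNReal.inv_ne_top.2 (ENNReal.zpow_pos (by simp) (by simp) _).ne'))
    filter_upwards [(ae_restrict_iff' measurableSet_ball).1 (ae_lt_top hm this)] with y hy hmem htop
    have := hy hmem
    rw [htop, ENNReal.top_rpow_of_pos hp2] at this
    exact this.ne rfl
  filter_upwards [ae_all_iff.2 hball] with y hy
  obtain ⟨k, hk⟩ := pow_unbounded_of_one_lt (dist y 0) one_lt_two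
  exact hy k (by simpa using hk)

/-- The trace inequality for Riesz potentials of order `α` and weights of Morrey type, by a Schur
test with the weight `v ^ t`, where `v` is the maximal majorant of `b` and `t > 1` is so close to `1`
that `T = 1 + t * (r - 1)` is still less than `p`. The two halves of the test are the bounds of the
potentials of `v ^ t` and of `v ^ T`. -/
theorem exists_lintegral_rpow_mul_rieszPotential_rpow_le {α : ℝ} (hα : 0 < α)
    (hαn : α < finrank ℝ E) {r p : ℝ} (hr : 1 < r) (hrp : r < p) :
    ∃ C : ℝ≥0∞, C ≠ ⊤ ∧ ∀ A : ℝ≥0∞, A ≠ ⊤ → ∀ b : E → ℝ≥0∞, Measurable b →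
      DyadicMorrey μ α p A b → ∀ f : E → ℝ≥0∞, Measurable f →
        ∫⁻ x, b x ^ r * rieszPotential μ α f x ^ r ∂μ ≤ C * A ^ r * ∫⁻ x, f x ^ r ∂μ := by
  have hp : 0 < p := by linarith
  have hr0 : 0 < r := by linarith
  have hr1 : 0 < r - 1 := by linarith
  have : Nontrivial E := by
    have : (0 : ℝ) < finrank ℝ E := hα.trans hαn
    exact nontrivial_of_finrank_pos (R := ℝ) (by exact_mod_cast this)
  -- small enough for `t = 1 + ε < p` and for `T = r + ε * (r - 1) < p`
  set ε : ℝ := (p - r) / p with hε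
  have hε0 : 0 < ε := div_pos (by linarith) hp
  have hεp : ε * p = p - r := by rw [hε]; field_simp
  have hε1 : ε < p - r := by
    rw [hε, div_lt_iff₀ hp]
    nlinarith
  have hε2 : ε * (r - 1) < p - r := by nlinarith
  set t : ℝ := 1 + ε with ht
  set T : ℝ := 1 + t * (r - 1) with hT
  have ht1 : 1 < t := by linarith
  have hT1 : 1 < T := by
    have : 0 < t * (r - 1) := by positivity
    linarith
  have hTp : T < p := by
    have : T = r + ε * (r - 1) := by rw [hT, ht]; ring
    linarith
  obtain ⟨C₁, hC₁, h₁⟩ := exists_rieszPotential_maximalMajorant_rpow_le μ hα hαn ht1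
    (by linarith : t < p)
  obtain ⟨C₂, hC₂, h₂⟩ := exists_rieszPotential_maximalMajorant_rpow_le μ hα hαn hT1 hTp
  refine ⟨C₁ ^ (r - 1) * C₂, ENNReal.mul_ne_top (ENNReal.rpow_ne_top_of_nonneg hr1.le hC₁) hC₂,
    fun A hA' b hb hM f hf => ?_⟩
  set v := maximalMajorant μ p b with hv
  have hvm : Measurable v := measurable_maximalMajorant μ p hb
  -- the weight vanishes somewhere only if `b = 0` almost everywhere
  by_cases hzero : ∃ x, v x = 0
  · obtain ⟨x, hx⟩ := hzero
    have : ∫⁻ x, b x ^ r * rieszPotential μ α f x ^ r ∂μ = ∫⁻ _, 0 ∂μ := by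
      refine lintegral_congr_ae ?_
      filter_upwards [ae_eq_zero_of_maximalMajorant_eq_zero μ hp hb hx] with y hy
      rw [hy, ENNReal.zero_rpow_of_pos hr0, zero_mul]
    rw [this, lintegral_zero]
    exact bot_le
  push Not at hzero
  have hA : A ≠ 0 := by
    rintro rfl
    refine hzero 0 ?_
    have : dyadicMaximal μ (fun y => b y ^ p) 0 = 0 := by
      refine le_antisymm (iSup_le fun k => (hM k 0).trans_eq ?_) bot_le
      rw [zero_mul, ENNReal.zero_rpow_of_pos hp]
    rw [hv, maximalMajorant, this, ENNReal.zero_rpow_of_pos (by positivity)]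
  have hvtop : ∀ᵐ x ∂μ, v x ≠ ⊤ := ae_maximalMajorant_ne_top μ hα hp hA' hb hM
  set w : E → ℝ≥0∞ := fun y => v y ^ t with hw
  have hwm : Measurable w := hvm.pow_const t
  have hw0 : ∀ᵐ x ∂μ, w x ≠ 0 ∧ w x ≠ ⊤ := by
    filter_upwards [hvtop] with x hx
    exact ⟨(ENNReal.rpow_pos (hzero x).bot_lt hx).ne',
      ENNReal.rpow_ne_top_of_nonneg (by linarith) hx⟩
  set h : E → ℝ≥0∞ := fun y => f y ^ r * w y ^ (-(r - 1)) with hh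
  have hhm : Measurable h := by fun_prop
  have hexp : r + (t - 1) * (r - 1) = T := by rw [hT]; ring
  calc ∫⁻ x, b x ^ r * rieszPotential μ α f x ^ r ∂μ
      ≤ ∫⁻ x, (C₁ * A) ^ (r - 1) * (v x ^ T * rieszPotential μ α h x) ∂μ := by
        refine lintegral_mono_ae ?_
        filter_upwards [ae_le_maximalMajorant μ hp hA' hb hM] with x hx
        calc b x ^ r * rieszPotential μ α f x ^ r
            ≤ v x ^ r * (rieszPotential μ α h x * (C₁ * A * v x ^ (t - 1)) ^ (r - 1)) := by
              gcongr
              refine (rieszPotential_rpow_le μ hr hf hwm hw0 x).trans ?_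
              gcongr
              exact h₁ A hA hA' b hb hM x
          _ = (C₁ * A) ^ (r - 1) * (v x ^ T * rieszPotential μ α h x) := by
              rw [ENNReal.mul_rpow_of_nonneg _ _ hr1.le, ← ENNReal.rpow_mul, ← hexp,
                ENNReal.rpow_add_of_nonneg _ _ hr0.le (mul_nonneg (by linarith) hr1.le)]
              ring
    _ = (C₁ * A) ^ (r - 1) * ∫⁻ x, h x * rieszPotential μ α (fun y => v y ^ T) x ∂μ := by
        have hIm : Measurable (rieszPotential μ α h) := measurable_rieszPotential μ α hhm
        rw [lintegral_const_mul _ (by fun_prop),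
          lintegral_mul_rieszPotential_comm μ α (hvm.pow_const T) hhm]
    _ ≤ (C₁ * A) ^ (r - 1) * ∫⁻ x, C₂ * A * f x ^ r ∂μ := by
        refine mul_le_mul_right (lintegral_mono_ae ?_) _
        filter_upwards [hvtop] with x hx
        calc h x * rieszPotential μ α (fun y => v y ^ T) x
            ≤ h x * (C₂ * A * v x ^ (T - 1)) := by
              gcongr
              exact h₂ A hA hA' b hb hM x
          _ = C₂ * A * f x ^ r * (v x ^ (t * -(r - 1)) * v x ^ (T - 1)) := by
              simp only [hh, hw]
              rw [← ENNReal.rpow_mul]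
              ring
          _ = C₂ * A * f x ^ r := by
              rw [← ENNReal.rpow_add _ _ (hzero x) hx, hT]
              ring_nf
              simp
    _ = C₁ ^ (r - 1) * C₂ * A ^ r * ∫⁻ x, f x ^ r ∂μ := by
        rw [lintegral_const_mul _ (hf.pow_const r), ENNReal.mul_rpow_of_nonneg _ _ hr1.le,
          ENNReal.rpow_sub _ _ hA hA', ENNReal.rpow_one]
        have : A ^ r / A * A = A ^ r := ENNReal.div_mul_cancel hA hA'
        calc _ = C₁ ^ (r - 1) * C₂ * (A ^ r / A * A) * ∫⁻ x, f x ^ r ∂μ := by ring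
          _ = _ := by rw [this]

end TraceInequality

/-! ### Potential bound by the gradient -/

section GradientRepresentation

open Metric Set Filter Module
open scoped ENNReal Topology

variable {E : Type*} [NormedAddCommGroup E] [NormedSpace ℝ E] [FiniteDimensional ℝ E]
  [MeasurableSpace E] [BorelSpace E] (μ : Measure E) [μ.IsAddHaarMeasure]

/-- Integration of the derivative along a ray that leaves the support. -/
lemma enorm_le_lintegral_fderiv_ray {u : E → ℝ} (hu : ContDiff ℝ 1 u) (hc : HasCompactSupport u)
    (x : E) {w : E} (hw : w ≠ 0) :
    ‖u x‖ₑ ≤ ∫⁻ s in Iio (0 : ℝ), ‖fderiv ℝ u (x + s • w)‖ₑ * ‖w‖ₑ := by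
  set f : ℝ → ℝ := fun s => u (x + s • w) with hf
  have hf1 : ContDiff ℝ 1 f := hu.comp (by fun_prop)
  have hfc : HasCompactSupport f := by
    refine hc.comp_isClosedEmbedding (g := fun s : ℝ => x + s • w) ?_
    exact (Homeomorph.addLeft x).isClosedEmbedding.comp (isClosedEmbedding_smul_left hw)
  have h := HasCompactSupport.enorm_le_lintegral_Ici_deriv hf1 hfc 0
  have h0 : f 0 = u x := by simp [hf]
  rw [h0, setLIntegral_congr Iio_ae_eq_Iic.symm] at h
  refine h.trans (lintegral_mono fun s => ?_)
  have hd : HasDerivAt f (fderiv ℝ u (x + s • w) w) s := by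
    have h1 : HasDerivAt (fun s : ℝ => x + s • w) w s := by
      simpa using ((hasDerivAt_id s).smul_const w).const_add x
    exact ((hu.differentiable one_ne_zero).differentiableAt.hasFDerivAt).comp_hasDerivAt s h1
  rw [hd.deriv]
  exact ContinuousLinearMap.le_opENorm _ _

/-- Every `z ≠ 0` lies in `s • {1 < ‖w‖ < 2}` for the `s < 0` of an interval of length `‖z‖ / 2`
only, whence the kernel `‖z‖ ^ (1 - n)`. -/
lemma lintegral_indicator_annulus_le (z : E) :
    ∫⁻ s in Iio (0 : ℝ), ENNReal.ofReal |(s ^ finrank ℝ E)⁻¹| *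
        {w : E | 1 < ‖w‖ ∧ ‖w‖ < 2}.indicator (fun _ => 1) (s⁻¹ • z) ≤
      2 ^ finrank ℝ E * ENNReal.ofReal (‖z‖ ^ (1 - finrank ℝ E : ℝ)) := by
  set n := finrank ℝ E with hn
  rcases eq_or_ne z 0 with rfl | hz
  · simp
  have hζ : 0 < ‖z‖ := norm_pos_iff.2 hz
  set ζ := ‖z‖ with hζ'
  calc ∫⁻ s in Iio (0 : ℝ), ENNReal.ofReal |(s ^ n)⁻¹| *
        {w : E | 1 < ‖w‖ ∧ ‖w‖ < 2}.indicator (fun _ => 1) (s⁻¹ • z)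
      ≤ ∫⁻ s in Iio (0 : ℝ), (Ioo (-ζ) (-(ζ / 2))).indicator
          (fun _ => ENNReal.ofReal ((ζ / 2) ^ n)⁻¹) s := by
        refine setLIntegral_mono' measurableSet_Iio fun s (hs : s < 0) => ?_
        by_cases h : s⁻¹ • z ∈ {w : E | 1 < ‖w‖ ∧ ‖w‖ < 2}
        · rw [indicator_of_mem h, mul_one]
          obtain ⟨h1, h2⟩ := h
          have hs' : 0 < -s := by linarith
          rw [norm_smul, norm_inv, Real.norm_eq_abs, abs_of_neg hs, inv_mul_eq_div] at h1 h2
          rw [lt_div_iff₀ hs'] at h1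
          rw [div_lt_iff₀ hs'] at h2
          rw [indicator_of_mem (by constructor <;> linarith)]
          refine ENNReal.ofReal_le_ofReal ?_
          rw [abs_inv, abs_pow, abs_of_neg hs]
          gcongr
          linarith
        · rw [indicator_of_notMem h, mul_zero]
          exact bot_le
    _ ≤ ∫⁻ s, (Ioo (-ζ) (-(ζ / 2))).indicator (fun _ => ENNReal.ofReal ((ζ / 2) ^ n)⁻¹) s :=
        setLIntegral_le_lintegral _ _
    _ = ENNReal.ofReal (((ζ / 2) ^ n)⁻¹ * (ζ / 2)) := by
        rw [lintegral_indicator measurableSet_Ioo, setLIntegral_const, Real.volume_Ioo,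
          ← ENNReal.ofReal_mul (by positivity)]
        congr 2
        ring
    _ ≤ ENNReal.ofReal (2 ^ n * ζ ^ (1 - n : ℝ)) := by
        refine ENNReal.ofReal_le_ofReal ?_
        rw [Real.rpow_sub hζ, Real.rpow_one, Real.rpow_natCast, div_pow]
        have : ((ζ ^ n / 2 ^ n)⁻¹ * (ζ / 2)) = 2 ^ n * (ζ / ζ ^ n) / 2 := by
          field_simp
        rw [this]
        exact half_le_self (by positivity)
    _ = _ := by
        rw [ENNReal.ofReal_mul (by positivity), ENNReal.ofReal_pow two_pos.le]
        simp

/-- Pointwise control of a compactly supported function by the Riesz potential of order one of its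
gradient: average the integrals of the derivative along the rays `x + s • w`, `s < 0`, over
`1 < ‖w‖ < 2`. -/
theorem exists_enorm_le_rieszPotential_fderiv [Nontrivial E] :
    ∃ C : ℝ≥0∞, C ≠ ⊤ ∧ ∀ u : E → ℝ, ContDiff ℝ 1 u → HasCompactSupport u → ∀ x,
      ‖u x‖ₑ ≤ C * rieszPotential μ 1 (fun y => ‖fderiv ℝ u y‖ₑ) x := by
  set n := finrank ℝ E with hn
  set N : Set E := {w : E | 1 < ‖w‖ ∧ ‖w‖ < 2} with hN
  have hNo : IsOpen N :=
    (isOpen_lt continuous_const continuous_norm).inter (isOpen_lt continuous_norm continuous_const)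
  have hNm : MeasurableSet N := hNo.measurableSet
  have hN0 : μ N ≠ 0 := by
    refine (hNo.measure_pos μ ?_).ne'
    obtain ⟨w, hw⟩ := exists_norm_eq E (c := 3 / 2) (by norm_num)
    exact ⟨w, by rw [hN, mem_ofPred_eq, hw]; norm_num⟩
  have hNt : μ N ≠ ⊤ := by
    refine ((measure_mono fun w hw => ?_).trans_lt
      (measure_ball_lt_top (μ := μ) (x := (0 : E)) (r := 2))).ne
    simpa using hw.2
  refine ⟨(μ N)⁻¹ * (2 * 2 ^ n), ENNReal.mul_ne_top (ENNReal.inv_ne_top.2 hN0)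
    (ENNReal.mul_ne_top (by simp) (by simp)), fun u hu hc x => ?_⟩
  set G : E → ℝ≥0∞ := fun y => ‖fderiv ℝ u y‖ₑ with hG
  have hGm : Measurable G := (hu.continuous_fderiv one_ne_zero).enorm.measurable
  set χ : E → ℝ≥0∞ := N.indicator fun _ => 1 with hχ
  have hχm : Measurable χ := measurable_const.indicator hNm
  have hkey : μ N * ‖u x‖ₑ ≤
      2 * 2 ^ n * rieszPotential μ 1 G x := by
    calc μ N * ‖u x‖ₑ = ∫⁻ w in N, ‖u x‖ₑ ∂μ := by rw [setLIntegral_const, mul_comm]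
      _ ≤ ∫⁻ w in N, ∫⁻ s in Iio (0 : ℝ), G (x + s • w) * 2 ∂volume ∂μ := by
          refine setLIntegral_mono' hNm fun w hw => ?_
          have hw0 : w ≠ 0 := by
            rintro rfl
            have := hw.1
            norm_num at this
          refine (enorm_le_lintegral_fderiv_ray hu hc x hw0).trans ?_
          gcongr with s
          rw [← ofReal_norm, ← ENNReal.ofReal_ofNat]
          exact ENNReal.ofReal_le_ofReal hw.2.le
      _ = ∫⁻ w, ∫⁻ s in Iio (0 : ℝ), χ w * (G (x + s • w) * 2) ∂volume ∂μ := by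
          rw [← lintegral_indicator hNm]
          congr 1
          funext w
          by_cases h : w ∈ N <;> simp [hχ, h]
      _ = ∫⁻ s in Iio (0 : ℝ), ∫⁻ w, χ w * (G (x + s • w) * 2) ∂μ :=
          lintegral_lintegral_swap (by fun_prop)
      _ = ∫⁻ s in Iio (0 : ℝ), ∫⁻ z, ENNReal.ofReal |(s ^ n)⁻¹| * χ (s⁻¹ • z) *
            (G (x + z) * 2) ∂μ := by
          refine setLIntegral_congr_fun measurableSet_Iio fun s (hs : s < 0) => ?_
          have hmap := Measure.map_addHaar_smul μ hs.ne
          have hm : Measurable fun z => χ (s⁻¹ • z) * (G (x + z) * 2) := by fun_prop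
          have h1 := lintegral_map (μ := μ) hm (measurable_const_smul s)
          rw [hmap, lintegral_smul_measure] at h1
          simp only [smul_smul, inv_mul_cancel₀ hs.ne, one_smul] at h1
          rw [← h1, smul_eq_mul, ← lintegral_const_mul _ hm]
          simp only [mul_assoc, hn]
      _ = ∫⁻ z, ∫⁻ s in Iio (0 : ℝ), ENNReal.ofReal |(s ^ n)⁻¹| * χ (s⁻¹ • z) *
            (G (x + z) * 2) ∂volume ∂μ :=
          lintegral_lintegral_swap (by fun_prop)
      _ ≤ ∫⁻ z, 2 ^ n * ENNReal.ofReal (‖z‖ ^ (1 - n : ℝ)) * (G (x + z) * 2) ∂μ := by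
          refine lintegral_mono fun z => ?_
          rw [lintegral_mul_const _ (by fun_prop)]
          gcongr
          exact lintegral_indicator_annulus_le z
      _ = ∫⁻ z, 2 * 2 ^ n * (ENNReal.ofReal (‖x - (x + z)‖ ^ (1 - n : ℝ)) * G (x + z)) ∂μ := by
          congr 1
          funext z
          rw [sub_add_cancel_left, norm_neg]
          ring
      _ = 2 * 2 ^ n * rieszPotential μ 1 G x := by
          rw [lintegral_const_mul _ (by fun_prop), rieszPotential, ← hn,
            lintegral_add_left_eq_self
              (fun y => ENNReal.ofReal (‖x - y‖ ^ (1 - n : ℝ)) * G y) x]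
  calc ‖u x‖ₑ = (μ N)⁻¹ * (μ N * ‖u x‖ₑ) := by
        rw [← mul_assoc, ENNReal.inv_mul_cancel hN0 hNt, one_mul]
    _ ≤ (μ N)⁻¹ * (2 * 2 ^ n * rieszPotential μ 1 G x) := by gcongr
    _ = _ := by ring

end GradientRepresentation

/-! ### Potential bound by the fractional Laplacian -/

section FractionalRepresentation

open Metric Set Filter Module Complex
open scoped ENNReal Topology SchwartzMap

variable {V : Type*} [NormedAddCommGroup V] [InnerProductSpace ℝ V] [FiniteDimensional ℝ V]
  [MeasurableSpace V] [BorelSpace V]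

lemma continuous_fourierInv_of_integrable {F : V → ℂ} (hF : Integrable F) :
    Continuous (𝓕⁻ F) := by
  rw [Real.fourierInv_eq_fourier_comp_neg]
  exact VectorFourier.fourierIntegral_continuous Real.continuous_fourierChar (L := innerₗ V)
    continuous_inner hF.comp_neg

lemma integral_fourierInv_mul_eq {F H : V → ℂ} (hF : Integrable F) (hH : Integrable H) :
    ∫ w, 𝓕⁻ F w * H w = ∫ ξ, F ξ * 𝓕⁻ H ξ := by
  have h := VectorFourier.integral_fourierIntegral_smul_eq_flip (L := innerₗ V)
    Real.continuous_fourierChar continuous_inner hF.comp_neg hH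
  rw [flip_innerₗ] at h
  change ∫ w, 𝓕 (fun x => F (-x)) w • H w = ∫ x, F (-x) • 𝓕 H x at h
  rw [Real.fourierInv_eq_fourier_comp_neg F]
  simp only [smul_eq_mul] at h
  rw [h, ← integral_neg_eq_self]
  simp [Real.fourierInv_eq_fourier_neg]

/-- Convolution of `𝓕⁻ F` with a Gaussian, computed on the Fourier side. -/
lemma integral_mul_gaussian_eq {F : V → ℂ} (hF : Integrable F) {t : ℝ} (ht : 0 < t) (x : V) :
    ∫ ξ, F ξ * cexp (-t * ‖ξ‖ ^ 2 + 2 * Real.pi * I * inner ℝ x ξ) =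
      ∫ w, 𝓕⁻ F w * ((Real.pi / t) ^ (finrank ℝ V / 2 : ℂ) *
        cexp (-Real.pi ^ 2 * ‖x - w‖ ^ 2 / t)) := by
  have htre : 0 < (t : ℂ).re := by simpa
  set a : V → ℂ := fun ξ => cexp (-t * ‖ξ‖ ^ 2 + 2 * Real.pi * I * inner ℝ x ξ) with ha
  have hac : Continuous a := by fun_prop
  have hai : Integrable a := GaussianFourier.integrable_cexp_neg_mul_sq_norm_add htre _ x
  have hfa : 𝓕 a = fun w => (Real.pi / t : ℂ) ^ (finrank ℝ V / 2 : ℂ) *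
      cexp (-Real.pi ^ 2 * ‖x - w‖ ^ 2 / t) := by
    funext w
    exact fourier_gaussian_innerProductSpace' htre x w
  have hfai : Integrable (𝓕 a) := by
    rw [hfa]
    refine Integrable.const_mul ?_ _
    have hb : 0 < ((Real.pi ^ 2 / t : ℝ) : ℂ).re := by
      rw [ofReal_re]
      positivity
    have h := (GaussianFourier.integrable_cexp_neg_mul_sq_norm_add hb 0 (0 : V)).comp_sub_left x
    refine h.congr (Eventually.of_forall fun w => ?_)
    simp only [zero_mul, add_zero]
    congr 1
    push_cast
    ring
  have h := integral_fourierInv_mul_eq hF hfai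
  rw [hac.fourierInv_fourier_eq hai hfai, hfa] at h
  exact h.symm

/-- Subordination of the Riesz kernel to Gaussians: `∫ t ^ (α/2 - 1) (π/t) ^ (n/2) e ^ (-π² z² / t)`
is a multiple of `z ^ (α - n)`. -/
lemma exists_lintegral_gaussian_eq {α n : ℝ} (hαn : α < n) :
    ∃ C : ℝ, ∀ z : ℝ, 0 < z →
      ∫⁻ t in Ioi (0 : ℝ), ENNReal.ofReal
        (t ^ (α / 2 - 1) * ((Real.pi / t) ^ (n / 2) * Real.exp (-Real.pi ^ 2 * z ^ 2 / t))) =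
      ENNReal.ofReal (C * z ^ (α - n)) := by
  set a : ℝ := (n - α) / 2 with ha
  have ha0 : 0 < a := by
    rw [ha]
    linarith
  refine ⟨Real.pi ^ (n / 2) * ((1 / Real.pi ^ 2) ^ a * Real.Gamma a), fun z hz => ?_⟩
  have hπz : 0 < Real.pi ^ 2 * z ^ 2 := by positivity
  have hΓ := Real.integral_rpow_mul_exp_neg_mul_Ioi ha0 hπz
  rw [← integral_comp_rpow_Ioi _ (p := -1) (by norm_num)] at hΓ
  have hcongr : ∫ t in Ioi (0 : ℝ),
      t ^ (α / 2 - 1) * ((Real.pi / t) ^ (n / 2) * Real.exp (-Real.pi ^ 2 * z ^ 2 / t)) =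
      Real.pi ^ (n / 2) * ((1 / (Real.pi ^ 2 * z ^ 2)) ^ a * Real.Gamma a) := by
    rw [← hΓ, ← integral_const_mul]
    refine setIntegral_congr_fun measurableSet_Ioi fun t (ht : 0 < t) => ?_
    simp only [smul_eq_mul, abs_neg, abs_one, one_mul]
    rw [Real.div_rpow Real.pi_pos.le ht.le, ← Real.rpow_mul ht.le,
      show Real.exp (-(Real.pi ^ 2 * z ^ 2 * t ^ (-1 : ℝ))) =
        Real.exp (-Real.pi ^ 2 * z ^ 2 / t) by rw [Real.rpow_neg_one]; ring_nf]
    have : t ^ (α / 2 - 1) / t ^ (n / 2) = t ^ (-1 - 1 : ℝ) * t ^ (-1 * (a - 1)) := by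
      rw [← Real.rpow_sub ht, ← Real.rpow_add ht]
      congr 1
      rw [ha]
      ring
    calc _ = Real.pi ^ (n / 2) * (t ^ (α / 2 - 1) / t ^ (n / 2)) *
          Real.exp (-Real.pi ^ 2 * z ^ 2 / t) := by ring
      _ = _ := by rw [this]; ring
  have hpos : 0 < Real.pi ^ (n / 2) * ((1 / (Real.pi ^ 2 * z ^ 2)) ^ a * Real.Gamma a) := by
    have := Real.Gamma_pos_of_pos ha0
    positivity
  rw [← ofReal_integral_eq_lintegral_ofReal
    (Integrable.of_integral_ne_zero (by rw [hcongr]; exact hpos.ne')), hcongr]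
  · congr 1
    have : (1 / (Real.pi ^ 2 * z ^ 2)) ^ a = (1 / Real.pi ^ 2) ^ a * z ^ (α - n) := by
      rw [← one_div_mul_one_div, Real.mul_rpow (by positivity) (by positivity), one_div (z ^ 2),
        ← Real.rpow_natCast z 2, ← Real.rpow_neg hz.le, ← Real.rpow_mul hz.le]
      congr 2
      rw [ha]
      push_cast
      ring
    rw [this]
    ring
  · filter_upwards [self_mem_ae_restrict measurableSet_Ioi] with t (ht : 0 < t)
    simp only [Pi.zero_apply]
    positivity

lemma integrable_rpow_norm_mul_schwartz (g : 𝓢(V, ℂ)) {α : ℝ} (hα : 0 < α) :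
    Integrable fun ξ : V => (((2 * Real.pi * ‖ξ‖) ^ α : ℝ) : ℂ) * g ξ := by
  obtain ⟨k, hk⟩ := exists_nat_ge α
  have h0 := g.integrable_pow_mul volume 0
  have h1 := g.integrable_pow_mul volume k
  refine ((h0.add h1).const_mul ((2 * Real.pi) ^ α)).mono' ?_ (Eventually.of_forall fun ξ => ?_)
  · refine (Measurable.mul ?_ g.continuous.measurable).aestronglyMeasurable
    fun_prop
  · simp only [Pi.add_apply, pow_zero, one_mul]
    rw [norm_mul, norm_real, Real.norm_of_nonneg (by positivity),
      Real.mul_rpow (by positivity) (norm_nonneg _), mul_assoc]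
    gcongr
    rw [← one_add_mul]
    gcongr
    rcases le_total ‖ξ‖ 1 with h | h
    · exact (Real.rpow_le_one (norm_nonneg _) h hα.le).trans
        (le_add_of_nonneg_right (by positivity))
    · rw [← Real.rpow_natCast]
      exact (Real.rpow_le_rpow_of_exponent_le h hk).trans
        (le_add_of_nonneg_left zero_le_one)

/-- Pointwise control of a Schwartz function by the Riesz potential of the Fourier multiplier
`(2 * π * ‖ξ‖) ^ α` applied to it. Since `‖ξ‖ ^ (-α)` is a superposition of the Gaussians
`exp (-t * ‖ξ‖ ^ 2)`, the function is a superposition of convolutions with Gaussians of the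
result. -/
theorem exists_enorm_le_rieszPotential_multiplier {α : ℝ} (hα : 0 < α)
    (hαn : α < finrank ℝ V) :
    ∃ C : ℝ≥0∞, C ≠ ⊤ ∧ ∀ (g : 𝓢(V, ℂ)) (x : V),
      ‖g x‖ₑ ≤ C * rieszPotential volume α
        (fun y => ‖𝓕⁻ (fun ξ : V => (((2 * Real.pi * ‖ξ‖) ^ α : ℝ) : ℂ) * 𝓕 (g : V → ℂ) ξ) y‖ₑ)
        x := by
  have hα2 : 0 < α / 2 := by positivity
  have : Nontrivial V := by
    have : (0 : ℝ) < finrank ℝ V := hα.trans hαn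
    exact nontrivial_of_finrank_pos (R := ℝ) (by exact_mod_cast this)
  obtain ⟨C, hC⟩ := exists_lintegral_gaussian_eq hαn
  set c : ℝ := (2 * Real.pi) ^ α * Real.Gamma (α / 2) with hc
  have hc0 : 0 < c := mul_pos (by positivity) (Real.Gamma_pos_of_pos hα2)
  have hce : ‖(c : ℂ)‖ₑ ≠ 0 := by simpa using hc0.ne'
  refine ⟨‖(c : ℂ)‖ₑ⁻¹ * ENNReal.ofReal C, ENNReal.mul_ne_top (ENNReal.inv_ne_top.2 hce)
    ENNReal.ofReal_ne_top, fun g x => ?_⟩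
  set F : V → ℂ := fun ξ => (((2 * Real.pi * ‖ξ‖) ^ α : ℝ) : ℂ) * 𝓕 (g : V → ℂ) ξ with hF
  have hFi : Integrable F := integrable_rpow_norm_mul_schwartz (𝓕 g) hα
  have hFm : Measurable F := by
    have : Measurable (𝓕 (g : V → ℂ)) := (𝓕 g).continuous.measurable
    fun_prop
  have hfm : Measurable (𝓕⁻ F) := (continuous_fourierInv_of_integrable hFi).measurable
  set e : V → ℂ := fun ξ => cexp (2 * Real.pi * I * inner ℝ x ξ) with he
  have henorm : ∀ ξ, ‖e ξ‖ = 1 := by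
    intro ξ
    simp only [he]
    rw [show (2 * Real.pi * I * inner ℝ x ξ : ℂ) = ((2 * Real.pi * inner ℝ x ξ : ℝ) : ℂ) * I by
      push_cast; ring_nf]
    exact norm_exp_ofReal_mul_I _
  set Φ : V → ℝ → ℂ := fun ξ t =>
    ((t ^ (α / 2 - 1) * Real.exp (-(‖ξ‖ ^ 2 * t)) : ℝ) : ℂ) * (F ξ * e ξ) with hΦ
  have hae : ∀ᵐ ξ : V, ξ ≠ 0 := by simp [ae_iff]
  have hΓ : ∀ ξ : V, ξ ≠ 0 → ∫ t in Ioi (0 : ℝ), t ^ (α / 2 - 1) * Real.exp (-(‖ξ‖ ^ 2 * t)) =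
      ‖ξ‖ ^ (-α) * Real.Gamma (α / 2) := by
    intro ξ hξ
    have hn : 0 < ‖ξ‖ := norm_pos_iff.2 hξ
    rw [Real.integral_rpow_mul_exp_neg_mul_Ioi hα2 (by positivity), one_div,
      ← Real.rpow_natCast ‖ξ‖ 2, ← Real.rpow_neg hn.le, ← Real.rpow_mul hn.le]
    congr 2
    push_cast
    ring
  have hΓi : ∀ ξ : V, ξ ≠ 0 → IntegrableOn
      (fun t : ℝ => t ^ (α / 2 - 1) * Real.exp (-(‖ξ‖ ^ 2 * t))) (Ioi 0) := by
    intro ξ hξ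
    refine Integrable.of_integral_ne_zero ?_
    rw [hΓ ξ hξ]
    have hn : 0 < ‖ξ‖ := norm_pos_iff.2 hξ
    have := Real.Gamma_pos_of_pos hα2
    positivity
  have hcancel : ∀ ξ : V, ξ ≠ 0 →
      ‖ξ‖ ^ (-α) * Real.Gamma (α / 2) * (2 * Real.pi * ‖ξ‖) ^ α = c := by
    intro ξ hξ
    have hn : 0 < ‖ξ‖ := norm_pos_iff.2 hξ
    rw [Real.mul_rpow (by positivity) hn.le, Real.rpow_neg hn.le, hc]
    have : ‖ξ‖ ^ α ≠ 0 := (Real.rpow_pos_of_pos hn α).ne'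
    field_simp
  have hgi : Integrable (𝓕 (g : V → ℂ)) := (𝓕 g).integrable
  -- the superposition of Gaussians, on the Fourier side
  have h1 : ∫ ξ, ∫ t in Ioi (0 : ℝ), Φ ξ t = c * g x := by
    have hinv : 𝓕⁻ (𝓕 (g : V → ℂ)) = g :=
      g.continuous.fourierInv_fourier_eq g.integrable hgi
    calc ∫ ξ, ∫ t in Ioi (0 : ℝ), Φ ξ t = ∫ ξ, (c : ℂ) * (e ξ * 𝓕 (g : V → ℂ) ξ) := by
          refine integral_congr_ae ?_
          filter_upwards [hae] with ξ hξ
          simp only [hΦ]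
          rw [integral_mul_const, integral_complex_ofReal, hΓ ξ hξ, ← hcancel ξ hξ, hF]
          push_cast
          ring
      _ = c * 𝓕⁻ (𝓕 (g : V → ℂ)) x := by
          rw [integral_const_mul, Real.fourierInv_eq']
          congr 2
          funext ξ
          rw [he, smul_eq_mul]
          congr 2
          rw [real_inner_comm]
          push_cast
          ring_nf
      _ = c * g x := by rw [hinv]
  have hΦi : Integrable (Function.uncurry Φ) (volume.prod (volume.restrict (Ioi (0 : ℝ)))) := by
    have hm : AEStronglyMeasurable (Function.uncurry Φ)
        (volume.prod (volume.restrict (Ioi (0 : ℝ)))) := by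
      refine Measurable.aestronglyMeasurable ?_
      have hem : Measurable e := by fun_prop
      simp only [hΦ, Function.uncurry_def]
      fun_prop
    rw [integrable_prod_iff hm]
    refine ⟨?_, ?_⟩
    · filter_upwards [hae] with ξ hξ
      exact ((hΓi ξ hξ).ofReal (𝕜 := ℂ)).mul_const (F ξ * e ξ)
    · refine (hgi.norm.const_mul c).congr ?_
      filter_upwards [hae] with ξ hξ
      have : ∀ t ∈ Ioi (0 : ℝ), ‖Function.uncurry Φ (ξ, t)‖ =
          t ^ (α / 2 - 1) * Real.exp (-(‖ξ‖ ^ 2 * t)) * ‖F ξ‖ := by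
        intro t ht
        have ht' : 0 < t := ht
        simp only [Function.uncurry_apply_pair, hΦ]
        rw [norm_mul, norm_mul, henorm, mul_one, norm_real, Real.norm_of_nonneg (by positivity)]
      rw [setIntegral_congr_fun measurableSet_Ioi this, integral_mul_const, hΓ ξ hξ, hF]
      simp only
      rw [norm_mul, norm_real, Real.norm_of_nonneg (by positivity), ← mul_assoc, hcancel ξ hξ]
  -- the same superposition, on the physical side
  have h2 : ∀ t ∈ Ioi (0 : ℝ), ‖∫ ξ, Φ ξ t‖ₑ ≤ ∫⁻ w, ENNReal.ofReal (t ^ (α / 2 - 1) *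
      ((Real.pi / t) ^ ((finrank ℝ V : ℝ) / 2) *
        Real.exp (-Real.pi ^ 2 * ‖x - w‖ ^ 2 / t))) * ‖𝓕⁻ F w‖ₑ := by
    intro t ht
    have ht' : 0 < t := ht
    have : ∫ ξ, Φ ξ t = ∫ w, ((t ^ (α / 2 - 1) *
      ((Real.pi / t) ^ ((finrank ℝ V : ℝ) / 2) *
        Real.exp (-Real.pi ^ 2 * ‖x - w‖ ^ 2 / t)) : ℝ) : ℂ) * 𝓕⁻ F w := by
      have h := integral_mul_gaussian_eq hFi ht' x
      have e1 : ∫ ξ, Φ ξ t = ((t ^ (α / 2 - 1) : ℝ) : ℂ) *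
          ∫ ξ, F ξ * cexp (-t * ‖ξ‖ ^ 2 + 2 * Real.pi * I * inner ℝ x ξ) := by
        rw [← integral_const_mul]
        congr 1
        funext ξ
        simp only [hΦ, he]
        rw [Complex.exp_add]
        push_cast
        rw [show -((‖ξ‖ : ℂ) ^ 2 * t) = -t * ‖ξ‖ ^ 2 by ring]
        ring
      rw [e1, h, ← integral_const_mul]
      congr 1
      funext w
      push_cast
      rw [Complex.ofReal_cpow ht'.le,
        Complex.ofReal_cpow (by positivity : 0 ≤ Real.pi / t)]
      push_cast
      ring
    rw [this]
    refine (enorm_integral_le_lintegral_enorm _).trans (le_of_eq ?_)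
    congr 1
    funext w
    rw [enorm_mul]
    congr 1
    rw [← ofReal_norm, norm_real, Real.norm_of_nonneg (by positivity)]
  have hkey : ‖(c : ℂ)‖ₑ * ‖g x‖ₑ ≤
      ENNReal.ofReal C * rieszPotential volume α (fun y => ‖𝓕⁻ F y‖ₑ) x := by
    calc ‖(c : ℂ)‖ₑ * ‖g x‖ₑ = ‖∫ t in Ioi (0 : ℝ), ∫ ξ, Φ ξ t‖ₑ := by
          rw [← enorm_mul, ← h1, integral_integral_swap hΦi]
      _ ≤ ∫⁻ t in Ioi (0 : ℝ), ‖∫ ξ, Φ ξ t‖ₑ := enorm_integral_le_lintegral_enorm _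
      _ ≤ ∫⁻ t in Ioi (0 : ℝ), ∫⁻ w, ENNReal.ofReal (t ^ (α / 2 - 1) *
            ((Real.pi / t) ^ ((finrank ℝ V : ℝ) / 2) *
              Real.exp (-Real.pi ^ 2 * ‖x - w‖ ^ 2 / t))) * ‖𝓕⁻ F w‖ₑ :=
          setLIntegral_mono' measurableSet_Ioi h2
      _ = ∫⁻ w, ∫⁻ t in Ioi (0 : ℝ), ENNReal.ofReal (t ^ (α / 2 - 1) *
            ((Real.pi / t) ^ ((finrank ℝ V : ℝ) / 2) *
              Real.exp (-Real.pi ^ 2 * ‖x - w‖ ^ 2 / t))) * ‖𝓕⁻ F w‖ₑ :=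
          lintegral_lintegral_swap (by fun_prop)
      _ = ∫⁻ w, ENNReal.ofReal C *
            (ENNReal.ofReal (‖x - w‖ ^ (α - finrank ℝ V)) * ‖𝓕⁻ F w‖ₑ) := by
          -- at `w = x` the integral over `t` is infinite, but the kernel is `0` by convention
          have hx : ∀ᵐ w : V, w ≠ x := by simp [ae_iff]
          refine lintegral_congr_ae ?_
          filter_upwards [hx] with w hw
          have hz : 0 < ‖x - w‖ := norm_pos_iff.2 (sub_ne_zero.2 hw.symm)
          rw [lintegral_mul_const _ (by fun_prop), hC _ hz,
            ENNReal.ofReal_mul' (by positivity), mul_assoc]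
      _ = _ := by
          rw [lintegral_const_mul _ (by fun_prop)]
          rfl
  calc ‖g x‖ₑ = ‖(c : ℂ)‖ₑ⁻¹ * (‖(c : ℂ)‖ₑ * ‖g x‖ₑ) := by
        rw [← mul_assoc, ENNReal.inv_mul_cancel hce (by simp), one_mul]
    _ ≤ ‖(c : ℂ)‖ₑ⁻¹ * (ENNReal.ofReal C * rieszPotential volume α (fun y => ‖𝓕⁻ F y‖ₑ) x) := by
        gcongr
    _ = _ := by ring

end FractionalRepresentation

/-! ### Weights satisfying the Morrey condition -/

section MorreyWeights

open Metric Set Filter Module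
open scoped ENNReal

variable {d : ℕ}

lemma MorreyBound.dyadicMorrey {α p A : ℝ} (hp : 0 < p) (hA : 0 ≤ A)
    {b b' : EuclideanSpace ℝ (Fin d) → ℝ} (hb : ∀ x, 0 ≤ b x) (hbb' : b =ᵐ[volume] b')
    (h : MorreyBound α p A b) :
    DyadicMorrey volume α p (ENNReal.ofReal A) fun x => ENNReal.ofReal (b' x) := by
  intro k x
  have hk : (0 : ℝ) < 2 ^ k := by positivity
  have h1 := h x (2 ^ k) hk
  rw [one_div, ENNReal.rpow_inv_le_iff hp] at h1
  have e : ENNReal.ofReal (A * ((2 : ℝ) ^ k) ^ (-α)) =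
      ENNReal.ofReal A * (((2 : ℝ≥0∞) ^ α) ^ k)⁻¹ := by
    rw [ENNReal.ofReal_mul hA, ← Real.rpow_intCast, ← Real.rpow_mul zero_le_two,
      ← ENNReal.ofReal_rpow_of_pos two_pos, ENNReal.ofReal_ofNat, ← ENNReal.rpow_intCast,
      ← ENNReal.rpow_mul, ← ENNReal.rpow_neg]
    congr 2
    ring
  rw [e] at h1
  refine le_of_eq_of_le ?_ h1
  rw [dyadicMean]
  refine laverage_congr (ae_restrict_of_ae ?_)
  filter_upwards [hbb'] with y hy
  rw [← hy, ENNReal.ofReal_rpow_of_nonneg (hb y) hp.le]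

/-- The trace inequality for real functions dominated by Riesz potentials. -/
lemma exists_lintegral_morrey_le {α r p : ℝ} (hα : 0 < α) (hαd : α < d) (hr : 1 < r)
    (hrp : r < p) {K : ℝ≥0∞} (hK : K ≠ ⊤) :
    ∃ N : ℝ, 0 < N ∧ ∀ (A : ℝ) (b : EuclideanSpace ℝ (Fin d) → ℝ),
      0 ≤ A → AEMeasurable b volume → (∀ x, 0 ≤ b x) → MorreyBound α p A b →
      ∀ (u : EuclideanSpace ℝ (Fin d) → ℝ) (f : EuclideanSpace ℝ (Fin d) → ℝ≥0∞), Measurable f →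
        (∀ x, ‖u x‖ₑ ≤ K * rieszPotential volume α f x) →
          ∫⁻ x, ENNReal.ofReal (b x ^ r * |u x| ^ r) ≤
            ENNReal.ofReal (N * A ^ r) * ∫⁻ x, f x ^ r := by
  have hr0 : 0 < r := by linarith
  have hp : 0 < p := by linarith
  obtain ⟨C, hC, h⟩ := exists_lintegral_rpow_mul_rieszPotential_rpow_le
    (volume : Measure (EuclideanSpace ℝ (Fin d))) hα (by simpa using hαd) hr hrp
  have hKr : K ^ r ≠ ⊤ := ENNReal.rpow_ne_top_of_nonneg hr0.le hK
  -- the summand `1` only serves to make the constant positive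
  refine ⟨(K ^ r * C).toReal + 1, by positivity, fun A b hA hbm hb hM u f hf hu => ?_⟩
  have h1 := h (ENNReal.ofReal A) ENNReal.ofReal_ne_top (fun x => ENNReal.ofReal (hbm.mk b x))
    hbm.measurable_mk.ennreal_ofReal (hM.dyadicMorrey hp hA hb hbm.ae_eq_mk) f hf
  have hIm := measurable_rieszPotential (volume : Measure (EuclideanSpace ℝ (Fin d))) α hf
  have hmk := hbm.measurable_mk
  calc ∫⁻ x, ENNReal.ofReal (b x ^ r * |u x| ^ r)
      ≤ ∫⁻ x, K ^ r * (ENNReal.ofReal (hbm.mk b x) ^ r * rieszPotential volume α f x ^ r) := by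
        refine lintegral_mono_ae ?_
        filter_upwards [hbm.ae_eq_mk] with x hx
        rw [← hx, ENNReal.ofReal_mul (by have := hb x; positivity),
          ← ENNReal.ofReal_rpow_of_nonneg (hb x) hr0.le,
          ← ENNReal.ofReal_rpow_of_nonneg (abs_nonneg _) hr0.le, ← Real.norm_eq_abs, ofReal_norm,
          mul_left_comm, ← ENNReal.mul_rpow_of_nonneg K _ hr0.le]
        gcongr
        exact hu x
    _ = K ^ r * ∫⁻ x, ENNReal.ofReal (hbm.mk b x) ^ r * rieszPotential volume α f x ^ r :=
        lintegral_const_mul _ (by fun_prop)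
    _ ≤ K ^ r * (C * ENNReal.ofReal A ^ r * ∫⁻ x, f x ^ r) := by gcongr
    _ = ENNReal.ofReal ((K ^ r * C).toReal * A ^ r) * ∫⁻ x, f x ^ r := by
        rw [ENNReal.ofReal_mul ENNReal.toReal_nonneg, ENNReal.ofReal_toReal
          (ENNReal.mul_ne_top hKr hC), ENNReal.ofReal_rpow_of_nonneg hA hr0.le]
        ring
    _ ≤ _ := by
        gcongr
        exact le_add_of_nonneg_right zero_le_one

end MorreyWeights

theorem corollary2 (d : ℕ) (α r p : ℝ) (hα : 0 < α) (hαd : α < d)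
    (hαr : α ≤ r) (hr : 1 < r) (hrp : r < p) (hpd : p ≤ d) :
    (∃ N : ℝ, 0 < N ∧
      ∀ (A : ℝ) (b : EuclideanSpace ℝ (Fin d) → ℝ),
        0 ≤ A → AEMeasurable b volume → (∀ x, 0 ≤ b x) → MorreyBound α p A b →
        ∀ u : EuclideanSpace ℝ (Fin d) → ℝ, ContDiff ℝ ∞ u → HasCompactSupport u →
          ∫⁻ x, ENNReal.ofReal (b x ^ r * |u x| ^ r) ≤
            ENNReal.ofReal (N * A ^ r) *
              ∫⁻ x, ENNReal.ofReal (‖fracLaplacian (α / 2) u x‖ ^ r)) ∧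
    (α = 1 → 2 ≤ d ∧
      ∃ N : ℝ, 0 < N ∧
        ∀ (A : ℝ) (b : EuclideanSpace ℝ (Fin d) → ℝ),
          0 ≤ A → AEMeasurable b volume → (∀ x, 0 ≤ b x) → MorreyBound 1 p A b →
          ∀ u : EuclideanSpace ℝ (Fin d) → ℝ, ContDiff ℝ ∞ u → HasCompactSupport u →
            ∫⁻ x, ENNReal.ofReal (b x ^ r * |u x| ^ r) ≤
              ENNReal.ofReal (N * A ^ r) * ∫⁻ x, ENNReal.ofReal (‖∇ u x‖ ^ r)) := by
  have hr0 : 0 ≤ r := by linarith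
  refine ⟨?_, ?_⟩
  · obtain ⟨K, hK, h⟩ := exists_enorm_le_rieszPotential_multiplier
      (V := EuclideanSpace ℝ (Fin d)) hα (by simpa using hαd)
    obtain ⟨N, hN, hmain⟩ := exists_lintegral_morrey_le hα hαd hr hrp hK
    refine ⟨N, hN, fun A b hA hbm hb hM u hu hc => ?_⟩
    have hc' : HasCompactSupport fun x => (u x : ℂ) := hc.comp_left Complex.ofReal_zero
    have hu' : ContDiff ℝ ∞ fun x => (u x : ℂ) := Complex.ofRealCLM.contDiff.comp hu
    set g := hc'.toSchwartzMap hu' with hg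
    have hfrac : fracLaplacian (α / 2) u = 𝓕⁻ (fun ξ : EuclideanSpace ℝ (Fin d) =>
        (((2 * Real.pi * ‖ξ‖) ^ α : ℝ) : ℂ) * 𝓕 (g : EuclideanSpace ℝ (Fin d) → ℂ) ξ) := by
      rw [fracLaplacian, mul_div_cancel₀ α two_ne_zero]
      rfl
    have hm : Measurable fun x => ‖fracLaplacian (α / 2) u x‖ₑ := by
      rw [hfrac]
      exact (continuous_fourierInv_of_integrable
        (integrable_rpow_norm_mul_schwartz (𝓕 g) hα)).enorm.measurable
    refine (hmain A b hA hbm hb hM u _ hm fun x => ?_).trans_eq ?_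
    · rw [hfrac]
      refine le_of_eq_of_le ?_ (h g x)
      rw [show g x = (u x : ℂ) from rfl, ← ofReal_norm, ← ofReal_norm, Complex.norm_real]
    · simp only [← ofReal_norm, ENNReal.ofReal_rpow_of_nonneg (norm_nonneg _) hr0]
  · rintro rfl
    have hd : 1 < d := by exact_mod_cast hαd
    have : Nontrivial (EuclideanSpace ℝ (Fin d)) :=
      Module.nontrivial_of_finrank_pos (R := ℝ) (by simp; omega)
    obtain ⟨K, hK, h⟩ := exists_enorm_le_rieszPotential_fderiv
      (volume : Measure (EuclideanSpace ℝ (Fin d)))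
    obtain ⟨N, hN, hmain⟩ := exists_lintegral_morrey_le hα hαd hr hrp hK
    refine ⟨hd, N, hN, fun A b hA hbm hb hM u hu hc => ?_⟩
    have hu1 : ContDiff ℝ 1 u := hu.of_le (by exact_mod_cast le_top)
    refine (hmain A b hA hbm hb hM u _
      (hu1.continuous_fderiv one_ne_zero).enorm.measurable (h u hu1 hc)).trans_eq ?_
    congr 1
    refine lintegral_congr fun x => ?_
    rw [gradient, LinearIsometryEquiv.norm_map, ← ofReal_norm,
      ENNReal.ofReal_rpow_of_nonneg (norm_nonneg _) hr0]
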